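/- Let $n\ge 5$ and let $\mathrm{Sym}(\mathbb C^2)^{\otimes n}=\{\psi\in(\mathbb C^2)^{\otimes n} : P_{i,j}\psi=\psi \text{ for all } i,j\}$ be the symmetric subspace, where $P_{i,j}$ exchanges the parties $i$ and $j$. States are given by vectors that need not be normalized, and a state is called fully entangled if all its single-party reduced density matrices have full rank. Then for almost every $\psi\in\mathrm{Sym}(\mathbb C^2)^{\otimes n}$, with respect to Lebesgue (Haar) measure on this finite-dimensional vector space, the following holds. (a) The local stabilizer of $\psi$ is trivial: $$\{S^{(1)}\otimes\cdots\otimes S^{(n)} : S^{(1)},\dots,S^{(n)}\in GL(2,\mathbb C),\ (S^{(1)}\otimes\cdots\otimes S^{(n)})\psi=\psi\}=\{\mathbb 1\}.$$ (b) $\psi$ is fully entangled and isolated under LOCC: if $\psi$ can be transformed deterministically by LOCC into a fully entangled $n$-qubit state $\varphi$, or if $\psi$ can be obtained deterministically by LOCC from an $n$-qubit state $\varphi$, then $\psi$ and $\varphi$ agree up to local unitaries and a scalar factor. Here a transformation by LOCC may use protocols with finitely many rounds as well as limits of these, in particular protocols with infinitely many rounds; that is, the normalized density operator of the target state lies in the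 closure of the set of outputs of finite-round LOCC protocols applied to the normalized density operator of the initial state. -/

import Mathlib

open MeasureTheory Matrix

noncomputable section

/-- The labels `x = (x₁, …, xₙ)` of the computational basis of `(ℂ²)^{⊗ n}`. -/
abbrev BitString (n : ℕ) : Type := Fin n → Fin 2

/-- The Hilbert space `(ℂ²)^{⊗ n}`: a vector is the family of its amplitudes in the orthonormal
basis `|x₁ … xₙ⟩`. Vectors are not normalized. -/
abbrev QubitState (n : ℕ) : Type := EuclideanSpace ℂ (BitString n)

/-- Operators on `(ℂ²)^{⊗ n}`, as matrices in the computational basis. -/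
abbrev QubitOp (n : ℕ) : Type := Matrix (BitString n) (BitString n) ℂ

/-- The symmetric subspace `Sym(ℂ²)^{⊗ n}`: the vectors fixed by every operator `P_{i,j}`
that exchanges the parties `i` and `j`. -/
def symSubspace (n : ℕ) : Submodule ℂ (QubitState n) where
  carrier := {ψ | ∀ (i j : Fin n) (x : BitString n), ψ (x ∘ Equiv.swap i j) = ψ x}
  add_mem' := by
    intro a b ha hb i j x
    simp [ha i j x, hb i j x]
  zero_mem' := by
    intro i j x
    simp
  smul_mem' := by
    intro c a ha i j x
    simp [ha i j x]

/-- The local operator `S⁽¹⁾ ⊗ ⋯ ⊗ S⁽ⁿ⁾`. -/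
def tensorOp {n : ℕ} (S : Fin n → Matrix (Fin 2) (Fin 2) ℂ) : QubitOp n :=
  Matrix.of fun x y => ∏ k, S k (x k) (y k)

/-- The operator that acts as `M` on party `k` and as the identity on all other parties. -/
def siteOp {n : ℕ} (k : Fin n) (M : Matrix (Fin 2) (Fin 2) ℂ) : QubitOp n :=
  tensorOp (Function.update (fun _ => 1) k M)

/-- The local stabilizer of `ψ`: all operators `S⁽¹⁾ ⊗ ⋯ ⊗ S⁽ⁿ⁾` with invertible factors
that fix `ψ`. -/
def localStabilizer {n : ℕ} (ψ : QubitState n) : Set (QubitOp n) :=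
  {T | ∃ S : Fin n → GL (Fin 2) ℂ,
    T = tensorOp (fun k => (S k : Matrix (Fin 2) (Fin 2) ℂ)) ∧ Matrix.toEuclideanLin T ψ = ψ}

/-- The reduced density matrix (up to normalization) of party `k` in the state `ψ`. -/
def reducedDensity {n : ℕ} (ψ : QubitState n) (k : Fin n) : Matrix (Fin 2) (Fin 2) ℂ :=
  Matrix.of fun a b => ∑ z : BitString n with z k = 0,
    ψ (Function.update z k a) * star (ψ (Function.update z k b))

/-- A state is fully entangled if all its single-party reduced density matrices have full rank. -/
def FullyEntangled {n : ℕ} (ψ : QubitState n) : Prop :=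
  ∀ k : Fin n, (reducedDensity ψ k).rank = 2

/-- The density operator `|ψ⟩⟨ψ| / ⟨ψ|ψ⟩` of the pure state given by the vector `ψ`. -/
def density {n : ℕ} (ψ : QubitState n) : QubitOp n :=
  ((‖ψ‖ ^ 2 : ℝ) : ℂ)⁻¹ • Matrix.of fun x y => ψ x * star (ψ y)

/-- LOCC protocols with finitely many rounds. Either the protocol stops, or some party `k`
performs a measurement with finitely many measurement operators `M i`, which satisfy the
completeness relation, and announces the outcome `i`; the protocol goes on depending on `i`.
Unitaries are the case of one outcome. Outcomes that are ignored later on are allowed, so local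
channels and coarse-grained measurements are covered; local ancillas yield nothing
more, since the operator that a party has applied so far can be replaced by the positive part of
its polar decomposition. -/
inductive LOCCProtocol (n : ℕ) : Type
  | halt : LOCCProtocol n
  | measure (k : Fin n) (r : ℕ) (M : Fin r → Matrix (Fin 2) (Fin 2) ℂ)
      (complete : ∑ i, (M i)ᴴ * M i = 1) (next : Fin r → LOCCProtocol n) : LOCCProtocol n

/-- The channel that a protocol implements: all outcomes are summed over. -/
def LOCCProtocol.channel {n : ℕ} : LOCCProtocol n → QubitOp n → QubitOp n
  | .halt, ρ => ρ
  | .measure k _ M _ next, ρ =>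
      ∑ i, (next i).channel (siteOp k (M i) * ρ * (siteOp k (M i))ᴴ)

/-- `ψ` can be transformed deterministically into `φ` by LOCC. The closure admits,
besides protocols with finitely many rounds, all limits of these, in particular protocols with
infinitely many rounds. -/
def LOCCConvertible {n : ℕ} (ψ φ : QubitState n) : Prop :=
  density φ ∈ closure (Set.range fun P : LOCCProtocol n => P.channel (density ψ))

/-- `ψ` and `φ` agree up to local unitaries (and a scalar, as vectors are not normalized). -/
def LUEquivalent {n : ℕ} (ψ φ : QubitState n) : Prop :=
  ∃ (U : Fin n → Matrix.unitaryGroup (Fin 2) ℂ) (c : ℂ), c ≠ 0 ∧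
    φ = c • Matrix.toEuclideanLin (tensorOp fun k => (U k : Matrix (Fin 2) (Fin 2) ℂ)) ψ

/-- `ψ` is isolated under LOCC: it can neither be converted into a fully entangled state nor be
reached from a state, other than trivially, that is, by local unitaries. -/
def LOCCIsolated {n : ℕ} (ψ : QubitState n) : Prop :=
  (∀ φ : QubitState n, FullyEntangled φ → LOCCConvertible ψ φ → LUEquivalent ψ φ) ∧
    ∀ φ : QubitState n, LOCCConvertible φ ψ → LUEquivalent φ ψ

end

/-! A generic symmetric state has no local symmetry, and isolation is a formal consequence of that.

Suppose that `ψ` has trivial stabilizer and converts to a fully entangled `φ`. Limits of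
finite-round protocols are still given by finitely many product Kraus operators
(`LOCCConvertible.exists_separable`), and since `φ` is pure, each of those with positive weight
sends `ψ` to a multiple of `φ`. Those with nonzero multiple are invertible, and two of them differ
by an operator that fixes `ψ` up to a scalar, so they are proportional. If `g` is one of them, the
completeness relation applied to `ψ` makes `ψ` an eigenvector of `gᴴ * g`. Hence `gᴴ * g` is scalar
and every factor of `g` is a multiple of a unitary (`LUEquivalent.of_localStabilizer`). If `ψ` is
the target, an invertible local operator maps the initial state to a multiple of `ψ`; so the initial
state has trivial stabilizer too, and the same argument applies to it.

The stabilizer is trivial under two generic conditions. A nonzero Hankel determinant of the first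
five amplitudes forces the factors of a stabilizing operator to be proportional
(`exists_smul_of_tensorOp_mulVec_eq`). What remains is a power of a single `S`. If `S` is not
scalar, then in a basis that diagonalizes `S` or brings it to Jordan form the state has at most `n /
2 + 1` nonzero amplitudes (`exists_frameState_eq`). Two parameters describe the basis, so these
states lie in finitely many smooth images of spaces of dimension at most `n / 2 + 3`. This is less
than the dimension `n + 1` of the symmetric subspace exactly when `n ≥ 5`, and then the images are
null sets. -/

theorem IsCompact.convexHull_of_finiteDimensional {E : Type*} [AddCommGroup E] [Module ℝ E]
    [TopologicalSpace E] [IsTopologicalAddGroup E] [ContinuousSMul ℝ E] [FiniteDimensional ℝ E]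
    {s : Set E} (hs : IsCompact s) : IsCompact (convexHull ℝ s) := by
  rcases s.eq_empty_or_nonempty with rfl | ⟨z₀, hz₀⟩
  · simp
  -- By Carathéodory, `N` points suffice for every convex combination, so the hull is a continuous
  -- image of a compact set. Shorter combinations are padded with weight 0 at `z₀`.
  set N := Module.finrank ℝ E + 1
  have hc : IsCompact (stdSimplex ℝ (Fin N) ×ˢ Set.univ.pi fun _ : Fin N => s) :=
    (isCompact_stdSimplex ℝ (Fin N)).prod (isCompact_univ_pi fun _ => hs)
  have hf : Continuous fun p : (Fin N → ℝ) × (Fin N → E) => ∑ i, p.1 i • p.2 i := by fun_prop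
  convert hc.image hf using 1
  refine Set.Subset.antisymm ?_ ?_
  · intro x hx
    obtain ⟨ι, _, z, w, hz, hind, hw, hw1, hx⟩ := eq_pos_convex_span_of_mem_convexHull hx
    have hcard : Fintype.card ι ≤ Fintype.card (Fin N) := by
      have := hind.card_le_finrank_succ
      have h2 := Submodule.finrank_le (vectorSpan ℝ (Set.range z))
      simp only [Fintype.card_fin]
      omega
    obtain ⟨e⟩ := Function.Embedding.nonempty_of_card_le hcard
    have hnot : ∀ i, i ∉ Set.range e → ¬ ∃ j, e j = i := fun i hi ⟨j, hj⟩ => hi ⟨j, hj⟩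
    refine ⟨(Function.extend e w 0, Function.extend e z fun _ => z₀), ⟨⟨fun i => ?_, ?_⟩, fun i _ => ?_⟩, ?_⟩
    · by_cases h : ∃ j, e j = i
      · obtain ⟨j, rfl⟩ := h
        simpa [e.injective.extend_apply] using (hw j).le
      · simp [Function.extend_apply' _ _ _ h]
    · rw [← hw1]
      refine (Fintype.sum_of_injective e e.injective _ _ (fun i hi => ?_) fun i => ?_).symm
      · simp [Function.extend_apply' _ _ _ (hnot i hi)]
      · simp [e.injective.extend_apply]
    · by_cases h : ∃ j, e j = i
      · obtain ⟨j, rfl⟩ := h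
        simpa [e.injective.extend_apply] using hz ⟨j, rfl⟩
      · simpa [Function.extend_apply' _ _ _ h] using hz₀
    · rw [← hx]
      refine (Fintype.sum_of_injective e e.injective _ _ (fun i hi => ?_) fun i => ?_).symm
      · simp [Function.extend_apply' _ _ _ (hnot i hi)]
      · simp [e.injective.extend_apply]
  · rintro _ ⟨⟨w, z⟩, ⟨⟨hw, hw1⟩, hz⟩, rfl⟩
    exact mem_convexHull_of_exists_fintype w z hw hw1 (fun i => hz i trivial) rfl

/-! ### Algebra of local operators -/

section TensorOp

variable {n : ℕ}

theorem tensorOp_apply (S : Fin n → Matrix (Fin 2) (Fin 2) ℂ) (x y : BitString n) :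
    tensorOp S x y = ∏ k, S k (x k) (y k) := rfl

theorem tensorOp_mul (S T : Fin n → Matrix (Fin 2) (Fin 2) ℂ) :
    tensorOp S * tensorOp T = tensorOp fun k => S k * T k := by
  ext x y
  simp only [Matrix.mul_apply, tensorOp_apply, ← Finset.prod_mul_distrib]
  exact (Finset.prod_univ_sum (fun _ => Finset.univ) fun k j => S k (x k) j * T k j (y k)).symm ▸
    by simp

theorem tensorOp_one : tensorOp (fun _ : Fin n => (1 : Matrix (Fin 2) (Fin 2) ℂ)) = 1 := by
  ext x y
  simp only [tensorOp_apply, Matrix.one_apply, Finset.prod_ite_zero, Finset.prod_const_one,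
    Finset.mem_univ, true_implies, funext_iff]

theorem tensorOp_conjTranspose (S : Fin n → Matrix (Fin 2) (Fin 2) ℂ) :
    (tensorOp S)ᴴ = tensorOp fun k => (S k)ᴴ := by
  ext x y
  simp [Matrix.conjTranspose_apply, tensorOp_apply]

theorem tensorOp_smul (c : Fin n → ℂ) (S : Fin n → Matrix (Fin 2) (Fin 2) ℂ) :
    tensorOp (fun k => c k • S k) = (∏ k, c k) • tensorOp S := by
  ext x y
  simp [tensorOp_apply, Finset.prod_mul_distrib]

theorem tensorOp_trace (S : Fin n → Matrix (Fin 2) (Fin 2) ℂ) :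
    (tensorOp S).trace = ∏ k, (S k).trace := by
  simp only [Matrix.trace, Matrix.diag_apply, tensorOp_apply]
  exact (Finset.prod_univ_sum (fun _ => Finset.univ) fun k j => S k j j).symm ▸ by simp

theorem continuous_tensorOp :
    Continuous (tensorOp : (Fin n → Matrix (Fin 2) (Fin 2) ℂ) → QubitOp n) := by
  unfold tensorOp
  refine continuous_matrix fun x y => ?_
  simp only [Matrix.of_apply]
  exact continuous_finsetProd _ fun k _ => ((continuous_apply k).matrix_elem (x k) (y k))

theorem tensorOp_mul_inv {S : Fin n → Matrix (Fin 2) (Fin 2) ℂ} (hS : ∀ k, IsUnit (S k).det) :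
    tensorOp S * tensorOp (fun k => (S k)⁻¹) = 1 := by
  rw [tensorOp_mul, ← tensorOp_one]
  congr 1
  ext1 k
  exact Matrix.mul_nonsing_inv _ (hS k)

theorem tensorOp_inv_mul {S : Fin n → Matrix (Fin 2) (Fin 2) ℂ} (hS : ∀ k, IsUnit (S k).det) :
    tensorOp (fun k => (S k)⁻¹) * tensorOp S = 1 := by
  rw [tensorOp_mul, ← tensorOp_one]
  congr 1
  ext1 k
  exact Matrix.nonsing_inv_mul _ (hS k)

/-- Summing out the bit of one party. -/
theorem sum_bitString_update (k : Fin n) {M : Type*} [AddCommMonoid M] (f : BitString n → M) :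
    ∑ y, f y = ∑ z : BitString n with z k = 0, ∑ a, f (Function.update z k a) := by
  rw [Finset.sum_sigma']
  refine Finset.sum_bij' (fun y _ => (⟨Function.update y k 0, y k⟩ : (_ : BitString n) × Fin 2))
    (fun p _ => Function.update p.1 k p.2) ?_ ?_ ?_ ?_ ?_
  · simp
  · simp
  · simp
  · rintro ⟨z, a⟩ h
    have hz : z k = 0 := by simpa using h
    simp [← hz]
  · simp

theorem siteOp_mulVec (k : Fin n) (M : Matrix (Fin 2) (Fin 2) ℂ) (v : BitString n → ℂ)
    (x : BitString n) :
    (siteOp k M *ᵥ v) x = ∑ a, M (x k) a * v (Function.update x k a) := by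
  have h : ∀ y : BitString n, siteOp k M x y =
      if Function.update y k (x k) = x then M (x k) (y k) else 0 := by
    intro y
    rw [siteOp, tensorOp_apply, ← Finset.mul_prod_erase _ _ (Finset.mem_univ k)]
    have : ∏ j ∈ Finset.univ.erase k,
        Function.update (fun _ => (1 : Matrix (Fin 2) (Fin 2) ℂ)) k M j (x j) (y j) =
        if Function.update y k (x k) = x then 1 else 0 := by
      rw [Finset.prod_congr rfl (g := fun j => if x j = y j then (1 : ℂ) else 0)]
      · rw [Finset.prod_ite_zero]
        congr 1
        · simp only [Finset.mem_erase, Finset.mem_univ, and_true, funext_iff, eq_iff_iff]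
          constructor
          · intro h j
            by_cases hj : j = k
            · subst hj; simp
            · simp [hj, h j hj]
          · intro h j hj
            have := h j
            simpa [hj, eq_comm] using this
        · simp
      · intro j hj
        rw [Function.update_of_ne (Finset.ne_of_mem_erase hj), Matrix.one_apply]
    rw [this]
    simp
  simp only [Matrix.mulVec, dotProduct, h]
  rw [sum_bitString_update k, Finset.sum_eq_single (Function.update x k 0)]
  · simp
  · intro z hz hne
    have hz : z k = 0 := by simpa using hz
    refine Finset.sum_eq_zero fun a _ => ?_
    rw [if_neg, zero_mul]
    rintro h
    apply hne
    rw [← h]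
    simp [← hz]
  · simp

end TensorOp

/-! ### Limits of LOCC protocols are separable maps -/

section Separable

variable {n : ℕ}

/-- The action of the local operator `⊗ S k` on an input `ρ`, recorded together with the
corresponding term of the completeness relation. -/
def krausPair (ρ : QubitOp n) (S : Fin n → Matrix (Fin 2) (Fin 2) ℂ) : QubitOp n × QubitOp n :=
  ((tensorOp S)ᴴ * tensorOp S, tensorOp S * ρ * (tensorOp S)ᴴ)

/-- Families of factors that are normalized in the Frobenius norm. -/
def normalizedFactors (n : ℕ) : Set (Fin n → Matrix (Fin 2) (Fin 2) ℂ) :=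
  {S | ∀ k, ((S k)ᴴ * S k).trace = 1}

theorem trace_conjTranspose_mul_self_eq (A : Matrix (Fin 2) (Fin 2) ℂ) :
    (Aᴴ * A).trace = ((∑ i, ∑ j, ‖A j i‖ ^ 2 : ℝ) : ℂ) := by
  simp only [Matrix.trace, Matrix.diag_apply, Matrix.mul_apply, Matrix.conjTranspose_apply]
  push_cast
  refine Finset.sum_congr rfl fun i _ => Finset.sum_congr rfl fun j _ => ?_
  exact Complex.conj_mul' _

theorem isCompact_normalizedFactors (n : ℕ) : IsCompact (normalizedFactors n) := by
  have hc : IsCompact (Set.univ.pi fun _ : Fin n => (Set.univ.pi fun _ : Fin 2 =>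
      Set.univ.pi fun _ : Fin 2 => Metric.closedBall (0 : ℂ) 1 : Set (Matrix (Fin 2) (Fin 2) ℂ))) :=
    isCompact_univ_pi fun _ => isCompact_univ_pi fun _ => isCompact_univ_pi fun _ =>
      isCompact_closedBall _ _
  refine hc.of_isClosed_subset ?_ ?_
  · have : normalizedFactors n =
        ⋂ k, {S : Fin n → Matrix (Fin 2) (Fin 2) ℂ | ((S k)ᴴ * S k).trace = 1} := by
      ext; simp [normalizedFactors]
    rw [this]
    refine isClosed_iInter fun k => isClosed_eq ?_ continuous_const
    have hk : Continuous fun S : Fin n → Matrix (Fin 2) (Fin 2) ℂ => S k := continuous_apply k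
    exact (hk.matrix_conjTranspose.matrix_mul hk).matrix_trace
  · intro S hS k _ i _ j _
    have h := (trace_conjTranspose_mul_self_eq (S k)).symm.trans (hS k)
    have h : (∑ i, ∑ j, ‖S k j i‖ ^ 2 : ℝ) = 1 := by exact_mod_cast h
    have h1 : ‖S k i j‖ ^ 2 ≤ ∑ j, ∑ i, ‖S k i j‖ ^ 2 :=
      (Finset.single_le_sum (f := fun i => ‖S k i j‖ ^ 2) (fun _ _ => by positivity)
        (Finset.mem_univ i)).trans
      (Finset.single_le_sum (f := fun j => ∑ i, ‖S k i j‖ ^ 2) (fun _ _ => by positivity)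
        (Finset.mem_univ j))
    rw [h] at h1
    simpa using (sq_le_one_iff₀ (norm_nonneg _)).1 h1

/-- The convex hull of the normalized Kraus pairs. -/
def krausHull (ρ : QubitOp n) : Set (QubitOp n × QubitOp n) :=
  convexHull ℝ (krausPair ρ '' normalizedFactors n)

theorem isCompact_krausHull (ρ : QubitOp n) : IsCompact (krausHull ρ) := by
  refine IsCompact.convexHull_of_finiteDimensional ((isCompact_normalizedFactors n).image ?_)
  have h := continuous_tensorOp (n := n)
  exact (h.matrix_conjTranspose.matrix_mul h).prodMk
    ((h.matrix_mul continuous_const).matrix_mul h.matrix_conjTranspose)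

/-- The trace of a tensor product is the product of the traces. This lets the weight of a cone
element be read off from its completeness term. -/
theorem trace_fst_of_mem_krausHull {ρ : QubitOp n} {p : QubitOp n × QubitOp n}
    (hp : p ∈ krausHull ρ) : p.1.trace = 1 := by
  have hconv : Convex ℝ {p : QubitOp n × QubitOp n | p.1.trace = 1} := by
    intro x hx y hy a b _ _ hab
    simp only [Set.mem_ofPred_eq] at hx hy ⊢
    simp only [Prod.fst_add, Prod.smul_fst, Matrix.trace_add, Matrix.trace_smul, hx, hy]
    rw [← add_smul, hab, one_smul]
  refine convexHull_min ?_ hconv hp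
  rintro _ ⟨S, hS, rfl⟩
  simp only [Set.mem_ofPred_eq, krausPair, tensorOp_conjTranspose, tensorOp_mul, tensorOp_trace]
  exact Finset.prod_eq_one fun k _ => hS k

/-- The cone over `krausHull`. -/
def krausCone (ρ : QubitOp n) : AddSubmonoid (QubitOp n × QubitOp n) where
  carrier := {p | ∃ w : ℝ, 0 ≤ w ∧ ∃ q ∈ krausHull ρ, p = w • q}
  zero_mem' := by
    have hne : (normalizedFactors n).Nonempty :=
      ⟨fun _ => Matrix.single 0 0 1, fun k => by simp [Matrix.trace_single_eq_same]⟩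
    obtain ⟨q, hq⟩ := (hne.image (krausPair ρ)).mono (subset_convexHull ℝ _)
    exact ⟨0, le_rfl, q, hq, by simp⟩
  add_mem' := by
    rintro _ _ ⟨a, ha, p, hp, rfl⟩ ⟨b, hb, q, hq, rfl⟩
    rcases (add_nonneg ha hb).eq_or_lt with h | h
    · obtain rfl : a = 0 := by linarith
      obtain rfl : b = 0 := by linarith
      exact ⟨0, le_rfl, p, hp, by simp⟩
    · refine ⟨a + b, h.le, (a / (a + b)) • p + (b / (a + b)) • q,
        convex_convexHull ℝ _ hp hq (by positivity) (by positivity) (by field_simp), ?_⟩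
      rw [smul_add, smul_smul, smul_smul, mul_div_cancel₀ _ h.ne', mul_div_cancel₀ _ h.ne']

theorem krausPair_smul (ρ : QubitOp n) (c : Fin n → ℝ)
    (S : Fin n → Matrix (Fin 2) (Fin 2) ℂ) :
    krausPair ρ (fun k => (c k : ℂ) • S k) = (∏ k, c k) ^ 2 • krausPair ρ S := by
  have h : ∀ A : QubitOp n, ((∏ k, c k) ^ 2) • A = ((∏ k, (c k : ℂ)) * ∏ k, (c k : ℂ)) • A := by
    intro A
    ext x y
    simp [Complex.real_smul, sq]
  have hstar : star (∏ k, (c k : ℂ)) = ∏ k, (c k : ℂ) := by simp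
  ext1 <;> simp only [krausPair, tensorOp_smul, Matrix.conjTranspose_smul, hstar, Prod.smul_fst,
    Prod.smul_snd, h, Matrix.smul_mul, Matrix.mul_smul, smul_smul]

-- Each factor is divided by its Frobenius norm; if some norm is 0, the whole pair vanishes.
open scoped ComplexOrder in
theorem krausPair_mem_krausCone (ρ : QubitOp n) (S : Fin n → Matrix (Fin 2) (Fin 2) ℂ) :
    krausPair ρ S ∈ krausCone ρ := by
  set c : Fin n → ℝ := fun k => Real.sqrt (∑ i, ∑ j, ‖S k j i‖ ^ 2) with hc
  have hsq : ∀ k, (c k) ^ 2 = ∑ i, ∑ j, ‖S k j i‖ ^ 2 := fun k =>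
    Real.sq_sqrt (by positivity)
  by_cases h0 : ∃ k, c k = 0
  · obtain ⟨k, hk⟩ := h0
    have hS : S k = 0 := by
      have h := trace_conjTranspose_mul_self_eq (S k)
      rw [← hsq k, hk] at h
      exact Matrix.trace_conjTranspose_mul_self_eq_zero_iff.1 (by simpa using h)
    have hT : tensorOp S = 0 := by
      ext x y
      rw [tensorOp_apply]
      exact Finset.prod_eq_zero (Finset.mem_univ k) (by simp [hS])
    have : krausPair ρ S = 0 := by simp [krausPair, hT]
    rw [this]
    exact zero_mem _
  · push Not at h0
    refine ⟨(∏ k, c k) ^ 2, by positivity, krausPair ρ fun k => (((c k)⁻¹ : ℝ) : ℂ) • S k,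
      subset_convexHull ℝ _ ⟨_, fun k => ?_, rfl⟩, ?_⟩
    · simp only [Matrix.conjTranspose_smul, Matrix.smul_mul, Matrix.mul_smul, smul_smul,
        Matrix.trace_smul, trace_conjTranspose_mul_self_eq, ← hsq]
      have := h0 k
      simp only [Complex.ofReal_inv, Complex.star_def, map_inv₀, Complex.conj_ofReal, smul_eq_mul,
        Complex.ofReal_pow]
      have : (c k : ℂ) ≠ 0 := by exact_mod_cast this
      field_simp
    · rw [krausPair_smul, smul_smul, ← mul_pow, ← Finset.prod_mul_distrib,
        Finset.prod_eq_one fun k _ => mul_inv_cancel₀ (h0 k)]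
      simp

/-- The induction runs over all product operators `S` already applied. Completeness of the next
measurement splits the term of `S` into the sum of the terms of its branches. -/
theorem LOCCProtocol.channel_mem_krausCone (ρ : QubitOp n) (P : LOCCProtocol n) :
    ∀ S : Fin n → Matrix (Fin 2) (Fin 2) ℂ,
      ((tensorOp S)ᴴ * tensorOp S, P.channel (tensorOp S * ρ * (tensorOp S)ᴴ)) ∈ krausCone ρ := by
  induction P with
  | halt => exact fun S => krausPair_mem_krausCone ρ S
  | measure k r M hM next ih =>
    intro S
    have hcomp : ∑ i, (siteOp k (M i))ᴴ * siteOp k (M i) = (1 : QubitOp n) := by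
      have hi : ∀ A : Matrix (Fin 2) (Fin 2) ℂ, ∀ x y : BitString n, siteOp k A x y =
          A (x k) (y k) * ∏ j ∈ Finset.univ.erase k, (1 : Matrix (Fin 2) (Fin 2) ℂ) (x j) (y j) := by
        intro A x y
        rw [siteOp, tensorOp_apply, ← Finset.mul_prod_erase _ _ (Finset.mem_univ k)]
        congr 1
        · simp
        · exact Finset.prod_congr rfl fun j hj => by
            rw [Function.update_of_ne (Finset.ne_of_mem_erase hj)]
      have h1 : ∀ i, (siteOp (n := n) k (M i))ᴴ * siteOp k (M i) = siteOp k ((M i)ᴴ * M i) := by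
        intro i
        rw [siteOp, tensorOp_conjTranspose, tensorOp_mul, siteOp]
        congr 1
        ext1 j
        by_cases hj : j = k
        · subst hj; simp
        · simp [Function.update_of_ne hj]
      have h2 : (1 : QubitOp n) = siteOp k 1 := by
        rw [siteOp, Function.update_eq_self, tensorOp_one]
      rw [h2, ← hM]
      ext x y
      simp only [h1, Matrix.sum_apply, hi, Finset.sum_mul]
    have hT : ∀ i, siteOp k (M i) * tensorOp S =
        tensorOp (fun j => Function.update (fun _ => 1) k (M i) j * S j) := fun i => by
      rw [siteOp, tensorOp_mul]
    have hsum : ((tensorOp S)ᴴ * tensorOp S, (LOCCProtocol.measure k r M hM next).channel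
        (tensorOp S * ρ * (tensorOp S)ᴴ)) =
        ∑ i, ((siteOp k (M i) * tensorOp S)ᴴ * (siteOp k (M i) * tensorOp S),
          (next i).channel ((siteOp k (M i) * tensorOp S) * ρ * (siteOp k (M i) * tensorOp S)ᴴ)) := by
      refine Prod.ext ?_ ?_
      · rw [Prod.fst_sum]
        have : ∀ i, (siteOp k (M i) * tensorOp S)ᴴ * (siteOp k (M i) * tensorOp S) =
            (tensorOp S)ᴴ * ((siteOp k (M i))ᴴ * siteOp k (M i)) * tensorOp S := by
          intro i
          simp only [Matrix.conjTranspose_mul, Matrix.mul_assoc]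
        simp only [this]
        rw [← Finset.sum_mul, ← Finset.mul_sum, hcomp, Matrix.mul_one]
      · rw [Prod.snd_sum]
        simp only [LOCCProtocol.channel, Matrix.conjTranspose_mul, Matrix.mul_assoc]
    rw [hsum]
    refine sum_mem fun i _ => ?_
    rw [hT]
    exact ih i _

/-- Limits of finite-round protocols are separable: a conversion is achieved by finitely
many local Kraus operators. -/
theorem LOCCConvertible.exists_separable {ψ φ : QubitState n} (h : LOCCConvertible ψ φ) :
    ∃ (ι : Type) (_ : Fintype ι) (w : ι → ℝ) (S : ι → Fin n → Matrix (Fin 2) (Fin 2) ℂ),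
      (∀ b, 0 ≤ w b) ∧ ∑ b, w b • ((tensorOp (S b))ᴴ * tensorOp (S b)) = 1 ∧
      ∑ b, w b • (tensorOp (S b) * density ψ * (tensorOp (S b))ᴴ) = density φ := by
  set ρ := density ψ
  -- This is the trace of the identity, hence the total weight of any complete family.
  set d : ℝ := 2 ^ n
  have hd : d ≠ 0 := by positivity
  -- Keeping the completeness relation in the pair puts all outputs in one compact set, so the
  -- relation survives the limit.
  have hmem : ∀ σ ∈ closure (Set.range fun P : LOCCProtocol n => P.channel ρ),
      d⁻¹ • ((1 : QubitOp n), σ) ∈ krausHull ρ := by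
    have hcont : Continuous fun σ : QubitOp n => d⁻¹ • ((1 : QubitOp n), σ) := by fun_prop
    intro σ hσ
    have hcl : IsClosed ((fun σ : QubitOp n => d⁻¹ • ((1 : QubitOp n), σ)) ⁻¹' krausHull ρ) :=
      (isCompact_krausHull ρ).isClosed.preimage hcont
    refine closure_minimal ?_ hcl hσ
    rintro _ ⟨P, rfl⟩
    obtain ⟨w, hw, q, hq, he⟩ := P.channel_mem_krausCone ρ fun _ => 1
    simp only [tensorOp_one, Matrix.conjTranspose_one, Matrix.mul_one, Matrix.one_mul] at he
    have ht := congrArg (fun p : QubitOp n × QubitOp n => p.1.trace) he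
    simp only [Prod.smul_fst, Matrix.trace_smul, trace_fst_of_mem_krausHull hq,
      Matrix.trace_one] at ht
    have hwd : w = d := by
      have : ((d : ℝ) : ℂ) = (w : ℂ) := by
        simpa [d, Complex.real_smul] using ht
      exact_mod_cast this.symm
    rw [Set.mem_preimage, he, hwd, inv_smul_smul₀ hd]
    exact hq
  obtain ⟨ι, _, w, z, hw, -, hz, hsum⟩ := mem_convexHull_iff_exists_fintype.1 (hmem _ h)
  choose S hS hSz using hz
  refine ⟨ι, inferInstance, fun b => d * w b, S, fun b => mul_nonneg (by positivity) (hw b), ?_⟩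
  have hsum' : ∑ b, (d * w b) • krausPair ρ (S b) = (1, density φ) := by
    simp only [hSz, mul_smul, ← Finset.smul_sum, hsum]
    exact smul_inv_smul₀ hd _
  have h1 := congrArg Prod.fst hsum'
  have h2 := congrArg Prod.snd hsum'
  rw [Prod.fst_sum] at h1
  rw [Prod.snd_sum] at h2
  exact ⟨h1, h2⟩

end Separable

/-! ### Trivial stabilizer implies isolation -/

section Isolation

variable {n : ℕ}

theorem density_eq_vecMulVec (ψ : QubitState n) :
    density ψ = ((‖ψ‖ ^ 2 : ℝ) : ℂ)⁻¹ • vecMulVec ψ.ofLp (star ψ.ofLp) := rfl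

theorem dotProduct_vecMulVec_star_mulVec {m : Type*} [Fintype m] (l u : m → ℂ) :
    l ⬝ᵥ (vecMulVec u (star u) *ᵥ star l) = ((‖l ⬝ᵥ u‖ ^ 2 : ℝ) : ℂ) := by
  rw [vecMulVec_mulVec, dotProduct_smul, dotProduct_comm (star u), star_dotProduct_star]
  rw [dotProduct_comm u l, op_smul_eq_mul]
  push_cast
  exact Complex.mul_conj' _

/-- If a mixture of the vectors `u b` is the pure state `φ`, all of them are multiples of `φ`. -/
theorem exists_smul_of_sum_vecMulVec {m ι : Type*} [Fintype m] [DecidableEq m] [Fintype ι]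
    (w : ι → ℝ) (hw : ∀ b, 0 ≤ w b) (u : ι → m → ℂ) (φ : m → ℂ) (hφ : φ ≠ 0) {e : ℝ} (he : 0 < e)
    (h : ∑ b, (w b : ℂ) • vecMulVec (u b) (star (u b)) = (e : ℂ) • vecMulVec φ (star φ)) :
    ∃ c : ι → ℂ, (∀ b, w b ≠ 0 → u b = c b • φ) ∧ ∃ b, w b ≠ 0 ∧ c b ≠ 0 := by
  have key : ∀ l : m → ℂ, ∑ b, w b * ‖l ⬝ᵥ u b‖ ^ 2 = e * ‖l ⬝ᵥ φ‖ ^ 2 := by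
    intro l
    have := congrArg (fun A : Matrix m m ℂ => l ⬝ᵥ (A *ᵥ star l)) h
    simp only [Matrix.sum_mulVec, Matrix.smul_mulVec, dotProduct_sum, dotProduct_smul,
      dotProduct_vecMulVec_star_mulVec, smul_eq_mul] at this
    exact_mod_cast this
  obtain ⟨x₀, hx₀⟩ := Function.ne_iff.1 hφ
  simp only [Pi.zero_apply] at hx₀
  refine ⟨fun b => u b x₀ / φ x₀, fun b hb => ?_, ?_⟩
  · ext x
    -- This functional annihilates `φ`, so every weighted square in the sum is zero; it compares the
    -- entries at `x` and `x₀`.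
    have hk := key (Pi.single x (φ x₀) - Pi.single x₀ (φ x))
    simp only [sub_dotProduct, single_dotProduct] at hk
    rw [mul_comm (φ x₀) (φ x), sub_self, norm_zero, zero_pow two_ne_zero, mul_zero] at hk
    have := (Finset.sum_eq_zero_iff_of_nonneg
      (fun b _ => mul_nonneg (hw b) (by positivity))).1 hk b (Finset.mem_univ b)
    have := (mul_eq_zero.1 this).resolve_left hb
    have := norm_eq_zero.1 (pow_eq_zero_iff two_ne_zero |>.1 this)
    simp only [Pi.smul_apply, smul_eq_mul]
    field_simp
    linear_combination this
  · by_contra! hcon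
    have hk := key (Pi.single x₀ 1)
    rw [Finset.sum_eq_zero] at hk
    · simp [he.ne', hx₀] at hk
    · intro b _
      by_cases hb : w b = 0
      · simp [hb]
      · have := hcon b hb
        simp only [div_eq_zero_iff, hx₀, or_false] at this
        simp [this]

theorem LOCCConvertible.exists_kraus {ψ φ : QubitState n} (h : LOCCConvertible ψ φ) (hφ : φ ≠ 0) :
    ∃ (ι : Type) (_ : Fintype ι) (w : ι → ℝ) (S : ι → Fin n → Matrix (Fin 2) (Fin 2) ℂ) (c : ι → ℂ),
      (∀ b, 0 ≤ w b) ∧ ∑ b, w b • ((tensorOp (S b))ᴴ * tensorOp (S b)) = 1 ∧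
      (∀ b, w b ≠ 0 → tensorOp (S b) *ᵥ ψ.ofLp = c b • φ.ofLp) ∧ ∃ b, w b ≠ 0 ∧ c b ≠ 0 := by
  obtain ⟨ι, _, w, S, hw, h1, h2⟩ := h.exists_separable
  have hφ' : φ.ofLp ≠ 0 := fun h0 => hφ (by ext x; simp [h0])
  have hφn : 0 < ‖φ‖ := norm_pos_iff.2 hφ
  have hb : ∀ b, w b • (tensorOp (S b) * density ψ * (tensorOp (S b))ᴴ) =
      ((w b * (‖ψ‖ ^ 2)⁻¹ : ℝ) : ℂ) •
        vecMulVec (tensorOp (S b) *ᵥ ψ.ofLp) (star (tensorOp (S b) *ᵥ ψ.ofLp)) := by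
    intro b
    rw [density_eq_vecMulVec, Matrix.mul_smul, Matrix.smul_mul, Matrix.mul_vecMulVec,
      Matrix.vecMulVec_mul, Matrix.star_mulVec]
    ext x y
    simp [Complex.real_smul, mul_assoc]
  simp only [hb] at h2
  rw [density_eq_vecMulVec, ← Complex.ofReal_inv] at h2
  obtain ⟨c, hc, b, hwb, hcb⟩ := exists_smul_of_sum_vecMulVec _
    (fun b => mul_nonneg (hw b) (by positivity)) _ φ.ofLp hφ' (by positivity) h2
  have hψ : (‖ψ‖ ^ 2)⁻¹ ≠ 0 := fun h0 => hwb (by simp [h0])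
  exact ⟨ι, inferInstance, w, S, c, hw, h1, fun b hb => hc b (mul_ne_zero hb hψ), b,
    fun h0 => hwb (by simp [h0]), hcb⟩

-- The reduced density matrix is `A * Aᴴ`, where the rows of `A` are the two slices of `ψ` at party
-- `k`. Full rank means that the slices are linearly independent.
open scoped ComplexOrder in
theorem fullyEntangled_iff {ψ : QubitState n} :
    FullyEntangled ψ ↔ ∀ (k : Fin n) (u : Fin 2 → ℂ),
      (∀ z : BitString n, ∑ a, u a * ψ (Function.update z k a) = 0) → u = 0 := by
  refine forall_congr' fun k => ?_
  set A : Matrix (Fin 2) (BitString n) ℂ :=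
    Matrix.of fun a z => if z k = 0 then ψ (Function.update z k a) else 0 with hA
  have hred : reducedDensity ψ k = A * Aᴴ := by
    ext a b
    simp only [reducedDensity, hA, Matrix.mul_apply, Matrix.conjTranspose_apply, Matrix.of_apply,
      Finset.sum_filter]
    refine Finset.sum_congr rfl fun z _ => ?_
    split_ifs <;> simp
  have hvec : ∀ u : Fin 2 → ℂ, u ᵥ* A = 0 ↔
      ∀ z : BitString n, ∑ a, u a * ψ (Function.update z k a) = 0 := by
    intro u
    simp only [funext_iff, Matrix.vecMul, dotProduct, hA, Matrix.of_apply, Pi.zero_apply]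
    constructor
    · intro h z
      have := h (Function.update z k 0)
      simpa using this
    · intro h z
      by_cases hz : z k = 0
      · simpa [hz] using h z
      · simp [hz]
  rw [hred, Matrix.rank_self_mul_conjTranspose]
  have hcard : A.rank = 2 ↔ LinearIndependent ℂ A.row := by
    rw [linearIndependent_iff_card_eq_finrank_span, Matrix.rank_eq_finrank_span_row,
      Fintype.card_fin, eq_comm]
    rfl
  rw [hcard, ← Matrix.vecMul_injective_iff]
  refine (injective_iff_map_eq_zero A.vecMulLinear).trans ?_
  simp only [Matrix.vecMulLinear_apply, hvec]

theorem tensorOp_update_mulVec_sum (S : Fin n → Matrix (Fin 2) (Fin 2) ℂ) (k : Fin n)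
    (u : Fin 2 → ℂ) (v : BitString n → ℂ) (z : BitString n) :
    ∑ a, u a * (tensorOp S *ᵥ v) (Function.update z k a) =
      ∑ y, (u ᵥ* S k) (y k) * (∏ j ∈ Finset.univ.erase k, S j (z j) (y j)) * v y := by
  simp only [Matrix.mulVec, Matrix.vecMul, dotProduct, Finset.mul_sum, Finset.sum_mul]
  rw [Finset.sum_comm]
  refine Finset.sum_congr rfl fun y _ => Finset.sum_congr rfl fun a _ => ?_
  rw [tensorOp_apply, ← Finset.mul_prod_erase _ _ (Finset.mem_univ k), Function.update_self,
    Finset.prod_congr rfl fun j hj => by rw [Function.update_of_ne (Finset.ne_of_mem_erase hj)]]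
  ring

/-- A left null vector of a singular factor annihilates the output when contracted with that party.
-/
theorem FullyEntangled.isUnit_det {φ : QubitState n} (hφ : FullyEntangled φ)
    {S : Fin n → Matrix (Fin 2) (Fin 2) ℂ} {v : BitString n → ℂ} {c : ℂ} (hc : c ≠ 0)
    (h : tensorOp S *ᵥ v = c • φ.ofLp) (k : Fin n) : IsUnit (S k).det := by
  rw [isUnit_iff_ne_zero]
  intro hdet
  obtain ⟨u, hu, hu0⟩ := Matrix.exists_vecMul_eq_zero_iff.2 hdet
  refine hu (fullyEntangled_iff.1 hφ k u fun z => ?_)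
  have := tensorOp_update_mulVec_sum S k u v z
  simp only [hu0, h, Pi.smul_apply, smul_eq_mul, Pi.zero_apply, zero_mul, Finset.sum_const_zero,
    mul_left_comm _ c, ← Finset.mul_sum] at this
  exact (mul_eq_zero.1 this).resolve_left hc

theorem FullyEntangled.ne_zero (hn : 0 < n) {φ : QubitState n} (hφ : FullyEntangled φ) :
    φ ≠ 0 := by
  rintro rfl
  have := fullyEntangled_iff.1 hφ ⟨0, hn⟩ 1 (by simp)
  exact one_ne_zero this

theorem exists_tensorOp_smul (hn : 0 < n) (c : ℂ) (hc : c ≠ 0)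
    (S : Fin n → Matrix (Fin 2) (Fin 2) ℂ) (hS : ∀ k, IsUnit (S k).det) :
    ∃ S' : Fin n → GL (Fin 2) ℂ,
      tensorOp (fun k => (S' k : Matrix (Fin 2) (Fin 2) ℂ)) = c • tensorOp S := by
  set d : Fin n → ℂ := Function.update 1 ⟨0, hn⟩ c with hd
  have hprod : ∏ k, d k = c := by
    rw [hd, Finset.prod_update_of_mem (Finset.mem_univ _)]
    simp
  have hd0 : ∀ k, d k ≠ 0 := fun k h0 => hc (by
    rw [← hprod]; exact Finset.prod_eq_zero (Finset.mem_univ k) h0)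
  refine ⟨fun k => Matrix.GeneralLinearGroup.mk'' (d k • S k) ?_, ?_⟩
  · rw [Matrix.det_smul]
    exact ((isUnit_iff_ne_zero.2 (hd0 k)).pow _).mul (hS k)
  · rw [← hprod, ← tensorOp_smul]
    rfl

theorem tensorOp_eq_smul_one_of_localStabilizer (hn : 0 < n) {ψ : QubitState n}
    (hψ : localStabilizer ψ = {1}) {S : Fin n → Matrix (Fin 2) (Fin 2) ℂ}
    (hS : ∀ k, IsUnit (S k).det) {c : ℂ} (hc : c ≠ 0)
    (h : tensorOp S *ᵥ ψ.ofLp = c • ψ.ofLp) : tensorOp S = c • 1 := by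
  obtain ⟨S', hS'⟩ := exists_tensorOp_smul hn c⁻¹ (inv_ne_zero hc) S hS
  have hmem : c⁻¹ • tensorOp S ∈ localStabilizer ψ := by
    refine ⟨S', hS'.symm, ?_⟩
    ext1 x
    rw [Matrix.ofLp_toLpLin, Matrix.toLin'_apply, Matrix.smul_mulVec, h, smul_smul, inv_mul_cancel₀ hc,
      one_smul]
  rw [hψ, Set.mem_singleton_iff] at hmem
  rw [← hmem, smul_smul, mul_inv_cancel₀ hc, one_smul]

theorem eq_smul_one_of_tensorOp_eq_smul_one {G : Fin n → Matrix (Fin 2) (Fin 2) ℂ} {s : ℂ}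
    (hs : s ≠ 0) (h : tensorOp G = s • 1) (k : Fin n) : G k 0 0 ≠ 0 ∧ G k = G k 0 0 • 1 := by
  have hent : ∀ a b, G k a b * ∏ j ∈ Finset.univ.erase k, G j 0 0 =
      s * (1 : Matrix (Fin 2) (Fin 2) ℂ) a b := by
    -- All other parties are frozen at the bit 0.
    intro a b
    have := congrFun (congrFun h (Function.update 0 k a)) (Function.update 0 k b)
    rw [tensorOp_apply, ← Finset.mul_prod_erase _ _ (Finset.mem_univ k), Function.update_self,
      Function.update_self, Finset.prod_congr rfl fun j hj => by
        rw [Function.update_of_ne (Finset.ne_of_mem_erase hj),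
          Function.update_of_ne (Finset.ne_of_mem_erase hj)]] at this
    rw [Pi.zero_def] at this
    rw [this, Matrix.smul_apply, Matrix.one_apply, Matrix.one_apply, smul_eq_mul]
    congr 2
    rw [eq_iff_iff]
    exact (Function.update_injective _ k).eq_iff
  have hp : ∏ j ∈ Finset.univ.erase k, G j 0 0 ≠ 0 := by
    intro h0
    have := hent 0 0
    simp [h0, hs.symm] at this
  have h00 := hent 0 0
  refine ⟨fun h0 => ?_, ?_⟩
  · simp [h0, hs.symm] at h00
  · ext a b
    apply mul_right_cancel₀ hp
    rw [hent a b, Matrix.smul_apply, smul_eq_mul, mul_right_comm, h00]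
    simp

theorem exists_unitary_of_conjTranspose_mul_self {g : Matrix (Fin 2) (Fin 2) ℂ} {t : ℂ}
    (ht : t ≠ 0) (h : gᴴ * g = t • 1) :
    ∃ (U : Matrix.unitaryGroup (Fin 2) ℂ) (r : ℂ), r ≠ 0 ∧
      g = r • (U : Matrix (Fin 2) (Fin 2) ℂ) := by
  have htr := trace_conjTranspose_mul_self_eq g
  rw [h, Matrix.trace_smul, Matrix.trace_one] at htr
  set R : ℝ := ∑ i, ∑ j, ‖g j i‖ ^ 2
  have hR : 0 ≤ R := by positivity
  have htR : t = ((R / 2 : ℝ) : ℂ) := by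
    push_cast
    rw [← htr]
    simp
  set r : ℝ := Real.sqrt (R / 2)
  have hr : ((r : ℝ) : ℂ) * r = t := by
    rw [htR, ← Complex.ofReal_mul, Real.mul_self_sqrt (by positivity)]
  have hr0 : (r : ℂ) ≠ 0 := fun h0 => ht (by rw [← hr, h0, mul_zero])
  refine ⟨⟨(r : ℂ)⁻¹ • g, ?_⟩, r, hr0, ?_⟩
  · rw [Matrix.mem_unitaryGroup_iff', Matrix.star_eq_conjTranspose, Matrix.conjTranspose_smul,
      Matrix.smul_mul, Matrix.mul_smul, h, smul_smul, smul_smul, ← hr]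
    have : star ((r : ℂ)⁻¹) = (r : ℂ)⁻¹ := by simp
    rw [this]
    field_simp
    simp
  · simp [smul_smul, mul_inv_cancel₀ hr0]

theorem LUEquivalent.of_localStabilizer (hn : 0 < n) {ψ φ : QubitState n}
    (hψ : localStabilizer ψ = {1}) (hφ : FullyEntangled φ) (h : LOCCConvertible ψ φ) :
    LUEquivalent ψ φ := by
  obtain ⟨ι, _, w, S, c, hw, hone, hS, b₀, hwb, hcb⟩ := h.exists_kraus (hφ.ne_zero hn)
  set g := S b₀
  have hg : ∀ k, IsUnit (g k).det := hφ.isUnit_det hcb (hS b₀ hwb)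
  have hterm : ∀ b, w b • (((tensorOp (S b))ᴴ * tensorOp (S b)) *ᵥ ψ.ofLp) =
      ((w b * ‖c b / c b₀‖ ^ 2 : ℝ) : ℂ) • (((tensorOp g)ᴴ * tensorOp g) *ᵥ ψ.ofLp) := by
    intro b
    by_cases hb : w b = 0
    · simp [hb]
    -- Such a Kraus operator may be singular, but it kills `ψ` and drops out of the completeness
    -- relation applied to `ψ`.
    by_cases hc : c b = 0
    · rw [← Matrix.mulVec_mulVec, hS b hb]
      simp [hc]
    have hSb : ∀ k, IsUnit (S b k).det := hφ.isUnit_det hc (hS b hb)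
    have hgS : tensorOp (fun k => (g k)⁻¹ * S b k) = (c b / c b₀) • 1 := by
      refine tensorOp_eq_smul_one_of_localStabilizer hn hψ (fun k => ?_) (div_ne_zero hc hcb) ?_
      · rw [Matrix.det_mul]
        exact (Matrix.isUnit_nonsing_inv_det _ (hg k)).mul (hSb k)
      · have hφg : φ.ofLp = (c b₀)⁻¹ • (tensorOp g *ᵥ ψ.ofLp) := by
          rw [hS b₀ hwb, smul_smul, inv_mul_cancel₀ hcb, one_smul]
        rw [← tensorOp_mul, ← Matrix.mulVec_mulVec, hS b hb, hφg, Matrix.mulVec_smul,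
          Matrix.mulVec_smul, Matrix.mulVec_mulVec, tensorOp_inv_mul hg, Matrix.one_mulVec,
          smul_smul, div_eq_mul_inv]
    have hSg : tensorOp (S b) = (c b / c b₀) • tensorOp g := by
      have := congrArg (fun A => tensorOp g * A) hgS
      simp only [← tensorOp_mul] at this
      rwa [← Matrix.mul_assoc, tensorOp_mul_inv hg, Matrix.one_mul, Matrix.mul_smul,
        Matrix.mul_one] at this
    rw [hSg, Matrix.conjTranspose_smul, Matrix.smul_mul, Matrix.mul_smul, smul_smul,
      Matrix.smul_mulVec, Complex.ofReal_mul, mul_smul (w b : ℂ)]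
    have : star (c b / c b₀) * (c b / c b₀) = ((‖c b / c b₀‖ ^ 2 : ℝ) : ℂ) := by
      push_cast
      exact Complex.conj_mul' _
    rw [this]
    rfl
  set r : ℝ := ∑ b, w b * ‖c b / c b₀‖ ^ 2 with hr
  have hr0 : 0 < r := by
    refine Finset.sum_pos' (fun b _ => mul_nonneg (hw b) (by positivity)) ⟨b₀, Finset.mem_univ _, ?_⟩
    rw [div_self hcb]
    simpa using (hw b₀).lt_of_ne' hwb
  have hr0' : (r : ℂ) ≠ 0 := by exact_mod_cast hr0.ne'
  have hfix : ψ.ofLp = (r : ℂ) • (((tensorOp g)ᴴ * tensorOp g) *ᵥ ψ.ofLp) := by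
    conv_lhs => rw [← Matrix.one_mulVec ψ.ofLp, ← hone, Matrix.sum_mulVec]
    simp only [Matrix.smul_mulVec, hterm]
    rw [← Finset.sum_smul, hr]
    push_cast
    rfl
  -- The operator `gᴴ * g` is itself an invertible local operator with eigenvector `ψ`, so
  -- triviality of the stabilizer applies a second time.
  have hG : tensorOp (fun k => (g k)ᴴ * g k) = (r : ℂ)⁻¹ • 1 := by
    refine tensorOp_eq_smul_one_of_localStabilizer hn hψ (fun k => ?_) (inv_ne_zero hr0') ?_
    · rw [Matrix.det_mul, Matrix.det_conjTranspose]
      exact (hg k).star.mul (hg k)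
    · rw [← tensorOp_mul, ← tensorOp_conjTranspose]
      conv_rhs => rw [hfix]
      rw [smul_smul, inv_mul_cancel₀ hr0', one_smul]
  have hU : ∀ k, ∃ (U : Matrix.unitaryGroup (Fin 2) ℂ) (r : ℂ), r ≠ 0 ∧
      g k = r • (U : Matrix (Fin 2) (Fin 2) ℂ) := fun k =>
    have := eq_smul_one_of_tensorOp_eq_smul_one (inv_ne_zero hr0') hG k
    exists_unitary_of_conjTranspose_mul_self this.1 this.2
  choose U q hq hgU using hU
  refine ⟨U, (c b₀)⁻¹ * ∏ k, q k, mul_ne_zero (inv_ne_zero hcb)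
    (Finset.prod_ne_zero_iff.2 fun k _ => hq k), ?_⟩
  have hφg : φ.ofLp = (c b₀)⁻¹ • (tensorOp g *ᵥ ψ.ofLp) := by
    rw [hS b₀ hwb, smul_smul, inv_mul_cancel₀ hcb, one_smul]
  have hgt : tensorOp g = (∏ k, q k) • tensorOp fun k => (U k : Matrix (Fin 2) (Fin 2) ℂ) := by
    rw [← tensorOp_smul]
    exact congrArg tensorOp (funext hgU)
  rw [hgt, Matrix.smul_mulVec, smul_smul] at hφg
  ext x
  rw [hφg]
  rfl

/-- Conjugation by `g` carries the stabilizer of `φ` into that of `ψ`. -/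
theorem localStabilizer_of_tensorOp_mulVec {ψ φ : QubitState n} (hψ : localStabilizer ψ = {1})
    {g : Fin n → Matrix (Fin 2) (Fin 2) ℂ} (hg : ∀ k, IsUnit (g k).det) {c : ℂ} (hc : c ≠ 0)
    (h : tensorOp g *ᵥ φ.ofLp = c • ψ.ofLp) : localStabilizer φ = {1} := by
  refine Set.Subset.antisymm ?_ ?_
  · rintro _ ⟨S, rfl, hS⟩
    have hS : tensorOp (fun k => (S k : Matrix (Fin 2) (Fin 2) ℂ)) *ᵥ φ.ofLp = φ.ofLp :=
      congrArg WithLp.ofLp hS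
    set T := tensorOp (fun k => (S k : Matrix (Fin 2) (Fin 2) ℂ))
    have hmem : tensorOp g * T * tensorOp (fun k => (g k)⁻¹) ∈ localStabilizer ψ := by
      refine ⟨fun k => Matrix.GeneralLinearGroup.mk'' (g k) (hg k) * S k *
        (Matrix.GeneralLinearGroup.mk'' (g k) (hg k))⁻¹, ?_, ?_⟩
      · rw [tensorOp_mul, tensorOp_mul]
        congr 1
      · have hψg : ψ.ofLp = c⁻¹ • (tensorOp g *ᵥ φ.ofLp) := by
          rw [h, smul_smul, inv_mul_cancel₀ hc, one_smul]
        ext1 x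
        rw [Matrix.ofLp_toLpLin, Matrix.toLin'_apply, hψg, Matrix.mulVec_smul, Matrix.mulVec_mulVec, Matrix.mul_assoc,
          tensorOp_inv_mul hg, Matrix.mul_one, ← Matrix.mulVec_mulVec, hS]
    rw [hψ, Set.mem_singleton_iff] at hmem
    have := congrArg (fun A => tensorOp (fun k => (g k)⁻¹) * A * tensorOp g) hmem
    simp only [Matrix.mul_one, tensorOp_inv_mul hg] at this
    rw [Matrix.mul_assoc, Matrix.mul_assoc, Matrix.mul_assoc, tensorOp_inv_mul hg, Matrix.mul_one,
      ← Matrix.mul_assoc, tensorOp_inv_mul hg, Matrix.one_mul] at this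
    exact this
  · rintro _ rfl
    exact ⟨fun _ => 1, by simp [tensorOp_one], by simp⟩

theorem LOCCIsolated.of_localStabilizer (hn : 0 < n) {ψ : QubitState n}
    (hψ : localStabilizer ψ = {1}) (hfe : FullyEntangled ψ) : LOCCIsolated ψ := by
  refine ⟨fun φ hφ h => LUEquivalent.of_localStabilizer hn hψ hφ h, fun φ h => ?_⟩
  obtain ⟨ι, _, w, S, c, -, -, hS, b₀, hwb, hcb⟩ := h.exists_kraus (hfe.ne_zero hn)
  exact LUEquivalent.of_localStabilizer hn (localStabilizer_of_tensorOp_mulVec hψ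
    (hfe.isUnit_det hcb (hS b₀ hwb)) hcb (hS b₀ hwb)) hfe h

end Isolation

/-! ### Symmetric states: the factors of a stabilizing operator are proportional -/

section Symmetric

variable {n : ℕ}

/-- Functions of bit strings that do not depend on the order of the bits. -/
def PermInvariant (v : BitString n → ℂ) : Prop :=
  ∀ (σ : Equiv.Perm (Fin n)) (x : BitString n), v (x ∘ σ) = v x

theorem permInvariant_of_mem_symSubspace {ψ : QubitState n} (hψ : ψ ∈ symSubspace n) :
    PermInvariant ψ.ofLp := by
  intro σ
  refine Equiv.Perm.swap_induction_on (motive := fun σ => ∀ x, ψ (x ∘ σ) = ψ x) σ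
    (fun x => rfl) ?_
  intro τ i j _ hτ x
  rw [Equiv.Perm.coe_mul, ← Function.comp_assoc, hτ, hψ i j x]

/-- The positions at which a bit string is `1`. -/
def ones (x : BitString n) : Finset (Fin n) := Finset.univ.filter fun k => x k = 1

/-- The bit string with ones exactly at the positions in `s`. -/
def bits (s : Finset (Fin n)) : BitString n := fun k => if k ∈ s then 1 else 0

theorem mem_ones {x : BitString n} {k : Fin n} : k ∈ ones x ↔ x k = 1 := by simp [ones]

theorem notMem_ones {x : BitString n} {k : Fin n} : k ∉ ones x ↔ x k = 0 := by
  rw [mem_ones]; omega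

@[simp] theorem ones_bits (s : Finset (Fin n)) : ones (bits s) = s := by
  ext k; simp [mem_ones, bits]

theorem bits_ones (x : BitString n) : bits (ones x) = x := by
  ext k
  simp only [bits, mem_ones]
  split_ifs with h
  · rw [h]
  · congr 1; omega

theorem update_bits_one (s : Finset (Fin n)) (k : Fin n) :
    Function.update (bits s) k 1 = bits (insert k s) := by
  ext j
  by_cases h : j = k
  · subst h; simp [bits]
  · simp [bits, h]

theorem update_bits_zero (s : Finset (Fin n)) (k : Fin n) :
    Function.update (bits s) k 0 = bits (s.erase k) := by
  ext j
  by_cases h : j = k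
  · subst h; simp [bits]
  · simp [bits, h]

/-- A bijection between the positions of the ones extends to a permutation of the parties. -/
theorem PermInvariant.apply_eq {v : BitString n → ℂ} (hv : PermInvariant v) {x y : BitString n}
    (h : (ones x).card = (ones y).card) : v x = v y := by
  have e : {k // x k = 1} ≃ {k // y k = 1} := Fintype.equivOfCardEq (by
    rw [Fintype.card_subtype, Fintype.card_subtype]; exact h)
  rw [← hv e.extendSubtype y]
  congr 1
  ext1 k
  by_cases hk : x k = 1
  · rw [Function.comp_apply, e.extendSubtype_mem k hk, hk]
  · have := e.extendSubtype_not_mem k hk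
    simp only [Function.comp_apply]
    omega

/-- The common value of a permutation invariant function on the bit strings with `m` ones. -/
def amplitude (v : BitString n → ℂ) (m : ℕ) : ℂ := v (bits (Finset.univ.filter fun k => k.val < m))

theorem card_filter_val_lt {m : ℕ} (hm : m ≤ n) :
    (Finset.univ.filter fun k : Fin n => k.val < m).card = m := by
  rw [Fin.card_filter_val_lt, min_eq_right hm]

theorem PermInvariant.eq_amplitude {v : BitString n → ℂ} (hv : PermInvariant v) (x : BitString n) :
    v x = amplitude v (ones x).card :=
  hv.apply_eq (by rw [ones_bits, card_filter_val_lt (card_finset_fin_le _)])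

theorem PermInvariant.apply_bits {v : BitString n → ℂ} (hv : PermInvariant v)
    (s : Finset (Fin n)) : v (bits s) = amplitude v s.card := by
  rw [hv.eq_amplitude, ones_bits]

theorem PermInvariant.tensorOp_mulVec_comp {v : BitString n → ℂ} (hv : PermInvariant v)
    (S : Fin n → Matrix (Fin 2) (Fin 2) ℂ) (σ : Equiv.Perm (Fin n)) (x : BitString n) :
    (tensorOp S *ᵥ v) (x ∘ σ) = (tensorOp (fun k => S (σ.symm k)) *ᵥ v) x := by
  simp only [Matrix.mulVec, dotProduct, tensorOp_apply]
  refine (Fintype.sum_equiv (Equiv.arrowCongr σ.symm (Equiv.refl (Fin 2))) _ _ fun y => ?_).symm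
  have hy : (Equiv.arrowCongr σ.symm (Equiv.refl (Fin 2))) y = y ∘ σ := rfl
  rw [hy, hv σ y]
  congr 1
  exact (Fintype.prod_equiv σ _ _ fun k => by simp).symm

theorem PermInvariant.tensorOp_mulVec {v : BitString n → ℂ} (hv : PermInvariant v)
    (g : Matrix (Fin 2) (Fin 2) ℂ) : PermInvariant (tensorOp (fun _ => g) *ᵥ v) :=
  fun σ x => hv.tensorOp_mulVec_comp _ σ x

/-- The determinant of the Hankel matrix `a (i + j)`, `0 ≤ i, j ≤ 2`. -/
def hankelDet (a : ℕ → ℂ) : ℂ :=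
  a 0 * (a 2 * a 4 - a 3 * a 3) - a 1 * (a 1 * a 4 - a 2 * a 3) + a 2 * (a 1 * a 3 - a 2 * a 2)

theorem eq_zero_of_hankelDet_ne_zero {a : ℕ → ℂ} (ha : hankelDet a ≠ 0) {p q r : ℂ}
    (h : ∀ m ≤ 2, p * a m + q * a (m + 1) + r * a (m + 2) = 0) : p = 0 ∧ q = 0 ∧ r = 0 := by
  have h0 := h 0 (by norm_num)
  have h1 := h 1 (by norm_num)
  have h2 := h 2 (by norm_num)
  norm_num at h0 h1 h2
  refine ⟨?_, ?_, ?_⟩ <;> apply mul_right_cancel₀ ha <;> rw [zero_mul, hankelDet]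
  -- The coefficients are the cofactors of the Hankel matrix (Cramer's rule).
  · linear_combination (a 2 * a 4 - a 3 * a 3) * h0 - (a 1 * a 4 - a 2 * a 3) * h1 +
      (a 1 * a 3 - a 2 * a 2) * h2
  · linear_combination -(a 1 * a 4 - a 2 * a 3) * h0 + (a 0 * a 4 - a 2 * a 2) * h1 -
      (a 0 * a 3 - a 1 * a 2) * h2
  · linear_combination (a 1 * a 3 - a 2 * a 2) * h0 - (a 0 * a 3 - a 1 * a 2) * h1 +
      (a 0 * a 2 - a 1 * a 1) * h2

/-- A dependence between the two slices at a party is a two-term recurrence for the amplitudes,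
which is a Hankel relation with last coefficient 0. -/
theorem fullyEntangled_of_hankelDet (hn : 4 ≤ n) {ψ : QubitState n} (hψ : PermInvariant ψ.ofLp)
    (hH : hankelDet (amplitude ψ.ofLp) ≠ 0) : FullyEntangled ψ := by
  refine fullyEntangled_iff.2 fun k u hu => ?_
  have h : ∀ m ≤ 2, u 0 * amplitude ψ.ofLp m + u 1 * amplitude ψ.ofLp (m + 1) +
      0 * amplitude ψ.ofLp (m + 2) = 0 := by
    intro m hm
    obtain ⟨s, hs, hcard⟩ := Finset.exists_subset_card_eq (s := Finset.univ.erase k) (n := m) (by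
      simp only [Finset.card_erase_of_mem (Finset.mem_univ k), Finset.card_fin]; omega)
    have hk : k ∉ s := fun hk => Finset.notMem_erase _ _ (hs hk)
    have := hu (bits s)
    rw [Fin.sum_univ_two, update_bits_zero, update_bits_one, hψ.apply_bits, hψ.apply_bits,
      Finset.erase_eq_of_notMem hk, Finset.card_insert_of_notMem hk, hcard] at this
    rw [this, zero_mul, zero_add]
  obtain ⟨h0, h1, -⟩ := eq_zero_of_hankelDet_ne_zero hH h
  ext a
  fin_cases a
  · exact h0
  · exact h1

theorem eq_smul_one_of_siteOp_eq (hn : 4 ≤ n) {v : BitString n → ℂ} (hv : PermInvariant v)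
    (hH : hankelDet (amplitude v) ≠ 0) {R : Matrix (Fin 2) (Fin 2) ℂ} {i j : Fin n} (hij : i ≠ j)
    (h : siteOp i R *ᵥ v = siteOp j R *ᵥ v) : R = R 0 0 • 1 := by
  have h3 : ∀ m ≤ 2, (-R 1 0) * amplitude v m + (R 0 0 - R 1 1) * amplitude v (m + 1) +
      R 0 1 * amplitude v (m + 2) = 0 := by
    -- The two sides are compared at a string with bit 0 at `i`, bit 1 at `j` and `m` further ones.
    -- Placing up to two ones elsewhere requires `4 ≤ n`.
    intro m hm
    obtain ⟨s, hs, hcard⟩ := Finset.exists_subset_card_eq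
      (s := (Finset.univ.erase i).erase j) (n := m) (by
        rw [Finset.card_erase_of_mem (by simp [hij.symm]),
          Finset.card_erase_of_mem (Finset.mem_univ i), Finset.card_fin]
        omega)
    have hj : j ∉ s := fun hk => Finset.notMem_erase _ _ (hs hk)
    have hi : i ∉ s := fun hk => by simpa using hs hk
    have hi' : i ∉ insert j s := by simp [hij, hi]
    have := congrFun h (bits (insert j s))
    have hxi : bits (insert j s) i = 0 := by simp [bits, hij, hi]
    have hxj : bits (insert j s) j = 1 := by simp [bits]
    rw [siteOp_mulVec, siteOp_mulVec, Fin.sum_univ_two, Fin.sum_univ_two, hxi, hxj] at this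
    simp only [update_bits_zero, update_bits_one, hv.apply_bits, Finset.erase_eq_of_notMem hi',
      Finset.card_insert_of_notMem hi', Finset.card_insert_of_notMem hj, Finset.erase_insert hj,
      Finset.insert_idem, hcard] at this
    linear_combination this
  obtain ⟨h10, h00, h01⟩ := eq_zero_of_hankelDet_ne_zero hH h3
  have h10 := neg_eq_zero.1 h10
  have h00 := sub_eq_zero.1 h00
  ext a b
  fin_cases a <;> fin_cases b <;> simp [h10, h01, h00]

theorem exists_smul_of_tensorOp_mulVec_eq (hn : 4 ≤ n) {v : BitString n → ℂ}
    (hv : PermInvariant v) (hH : hankelDet (amplitude v) ≠ 0)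
    {S : Fin n → Matrix (Fin 2) (Fin 2) ℂ} (hS : ∀ k, IsUnit (S k).det)
    (h : tensorOp S *ᵥ v = v) (i j : Fin n) : ∃ r : ℂ, S j = r • S i := by
  by_cases hij : i = j
  · exact ⟨1, by rw [hij, one_smul]⟩
  have hswap : tensorOp (fun k => S (Equiv.swap i j k)) *ᵥ v = v := by
    ext x
    have := hv.tensorOp_mulVec_comp S (Equiv.swap i j) x
    rw [h, hv, Equiv.symm_swap] at this
    exact this.symm
  -- By symmetry, exchanging `S i` and `S j` also gives an operator fixing `v`. `Q` cancels both
  -- operators up to the single factor `(S i)⁻¹ * S j`, which is left at `j` in one case and at `i`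
  -- in the other.
  set Q : Fin n → Matrix (Fin 2) (Fin 2) ℂ := Function.update (fun k => (S k)⁻¹) j (S i)⁻¹
  have h1 : tensorOp Q * tensorOp S = siteOp j ((S i)⁻¹ * S j) := by
    rw [tensorOp_mul, siteOp]
    congr 1
    ext1 k
    by_cases hk : k = j
    · subst hk; simp [Q]
    · simp [Q, hk, Matrix.nonsing_inv_mul _ (hS k)]
  have h2 : tensorOp Q * tensorOp (fun k => S (Equiv.swap i j k)) =
      siteOp i ((S i)⁻¹ * S j) := by
    rw [tensorOp_mul, siteOp]
    congr 1
    ext1 k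
    by_cases hk : k = j
    · subst hk
      simp [Q, Ne.symm hij, Matrix.nonsing_inv_mul _ (hS i)]
    · by_cases hki : k = i
      · subst hki; simp [Q, hij]
      · simp [Q, hk, hki, Equiv.swap_apply_of_ne_of_ne hki hk, Matrix.nonsing_inv_mul _ (hS k)]
  have hR := eq_smul_one_of_siteOp_eq hn hv hH hij (R := (S i)⁻¹ * S j) (by
    rw [← h1, ← h2, ← Matrix.mulVec_mulVec, ← Matrix.mulVec_mulVec, h, hswap])
  refine ⟨((S i)⁻¹ * S j) 0 0, ?_⟩
  have := congrArg (fun A => S i * A) hR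
  simpa only [← Matrix.mul_assoc, Matrix.mul_nonsing_inv _ (hS i), Matrix.one_mul,
    Matrix.mul_smul, Matrix.mul_one] using this

end Symmetric

/-! ### Normal forms of a 2 × 2 matrix in normalized bases -/

section NormalForm

/-- The two affine charts of the projective line. -/
def chart (b : Bool) (s : ℂ) : Fin 2 → ℂ := if b then ![1, s] else ![s, 1]

/-- The matrix whose columns are the representatives of two points of the projective line. -/
def frame (b c : Bool) (s t : ℂ) : Matrix (Fin 2) (Fin 2) ℂ := (Matrix.of ![chart b s, chart c t])ᵀ

theorem exists_chart {v : Fin 2 → ℂ} (hv : v ≠ 0) :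
    ∃ (b : Bool) (s r : ℂ), chart b s = r • v := by
  by_cases h : v 0 = 0
  · have h1 : v 1 ≠ 0 := fun h1 => hv (by ext i; fin_cases i <;> simp [h, h1])
    refine ⟨false, 0, (v 1)⁻¹, ?_⟩
    ext i; fin_cases i <;> simp [chart, h, h1]
  · refine ⟨true, (v 0)⁻¹ * v 1, (v 0)⁻¹, ?_⟩
    ext i; fin_cases i <;> simp [chart, h]

theorem chart_ne_zero (b : Bool) (s : ℂ) : chart b s ≠ 0 := by
  intro h
  cases b
  · simpa [chart] using congrFun h 1
  · simpa [chart] using congrFun h 0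

theorem exists_eigenvector_of_det {S : Matrix (Fin 2) (Fin 2) ℂ} {α : ℂ}
    (h : (S - α • 1).det = 0) : ∃ (b : Bool) (s : ℂ), S *ᵥ chart b s = α • chart b s := by
  obtain ⟨v, hv, hv0⟩ := Matrix.exists_mulVec_eq_zero_iff.2 h
  obtain ⟨b, s, r, hr⟩ := exists_chart hv
  refine ⟨b, s, ?_⟩
  rw [Matrix.sub_mulVec, Matrix.smul_mulVec, Matrix.one_mulVec, sub_eq_zero] at hv0
  rw [hr, Matrix.mulVec_smul, hv0, smul_comm]

theorem det_sub_smul_one (S : Matrix (Fin 2) (Fin 2) ℂ) (x : ℂ) :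
    (S - x • 1).det = (S 0 0 - x) * (S 1 1 - x) - S 0 1 * S 1 0 := by
  rw [Matrix.det_fin_two]; simp

/-- An invertible matrix that is not scalar is similar to a diagonal matrix with distinct
eigenvalues or to a Jordan block, and the columns of the transition matrix can be normalized. -/
theorem exists_frame_mul_eq {S : Matrix (Fin 2) (Fin 2) ℂ} (hS : ∀ r : ℂ, S ≠ r • 1) :
    ∃ (b c : Bool) (s t : ℂ) (D : Matrix (Fin 2) (Fin 2) ℂ), IsUnit (frame b c s t).det ∧
      S * frame b c s t = frame b c s t * D ∧ D 1 0 = 0 ∧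
      (D 0 1 = 0 ∧ D 0 0 ≠ D 1 1 ∨ D 0 1 ≠ 0 ∧ D 0 0 = D 1 1) := by
  obtain ⟨α, hα⟩ := spectrum.nonempty_of_isAlgClosed_of_finiteDimensional ℂ S
  have hα : (S - α • 1).det = 0 := by
    rw [spectrum.mem_iff, Matrix.isUnit_iff_isUnit_det, isUnit_iff_ne_zero, not_not,
      Algebra.algebraMap_eq_smul_one] at hα
    rw [← neg_sub, Matrix.det_neg, hα, mul_zero]
  -- The second eigenvalue, by the trace.
  set β := S 0 0 + S 1 1 - α with hβ
  obtain ⟨b, s, hv⟩ := exists_eigenvector_of_det hα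
  have hcol : ∀ (b c : Bool) (s t : ℂ) (D : Matrix (Fin 2) (Fin 2) ℂ),
      S *ᵥ chart b s = D 0 0 • chart b s + D 1 0 • chart c t →
      S *ᵥ chart c t = D 0 1 • chart b s + D 1 1 • chart c t →
      S * frame b c s t = frame b c s t * D := by
    intro b c s t D h0 h1
    ext i j
    have h0 := congrFun h0 i
    have h1 := congrFun h1 i
    simp only [Matrix.mulVec, dotProduct, Fin.sum_univ_two, Pi.add_apply, Pi.smul_apply,
      smul_eq_mul] at h0 h1
    rw [Matrix.mul_apply, Matrix.mul_apply, Fin.sum_univ_two, Fin.sum_univ_two]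
    fin_cases j
    · simp only [frame, Matrix.transpose_apply, Matrix.of_apply, Fin.zero_eta,
        Matrix.cons_val_zero, Matrix.cons_val_one]
      linear_combination h0
    · simp only [frame, Matrix.transpose_apply, Matrix.of_apply, Fin.mk_one,
        Matrix.cons_val_zero, Matrix.cons_val_one]
      linear_combination h1
  by_cases hne : α = β
  -- With a double eigenvalue, any completion of the eigenvector to a basis makes `S` triangular.
  -- The origin of the opposite chart always completes it.
  · obtain ⟨c, hdet⟩ : ∃ c, IsUnit (frame b c s 0).det := by
      refine ⟨!b, ?_⟩
      cases b <;> simp [frame, chart, Matrix.det_fin_two]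
    set g := frame b c s 0 with hg
    set D := g⁻¹ * S * g with hD
    have hmul : S * g = g * D := by
      rw [hD, Matrix.mul_assoc g⁻¹, ← Matrix.mul_assoc, Matrix.mul_nonsing_inv _ hdet,
        Matrix.one_mul]
    have hgv : g *ᵥ Pi.single 0 1 = chart b s := by
      rw [Matrix.mulVec_single_one]
      rfl
    have hDv : D *ᵥ Pi.single 0 1 = α • Pi.single 0 1 := by
      rw [hD, ← Matrix.mulVec_mulVec, hgv, ← Matrix.mulVec_mulVec, hv, Matrix.mulVec_smul, ← hgv,
        Matrix.mulVec_mulVec, Matrix.nonsing_inv_mul _ hdet, Matrix.one_mulVec]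
    rw [Matrix.mulVec_single_one] at hDv
    have h00 : D 0 0 = α := by simpa using congrFun hDv 0
    have h10 : D 1 0 = 0 := by simpa using congrFun hDv 1
    have htr : D.trace = S.trace := by
      rw [hD, Matrix.trace_mul_cycle, Matrix.mul_nonsing_inv _ hdet, Matrix.one_mul]
    rw [Matrix.trace_fin_two, Matrix.trace_fin_two] at htr
    have h11 : D 0 0 = D 1 1 := by
      rw [h00]
      linear_combination hne - htr + h00 + hβ
    refine ⟨b, c, s, 0, D, hdet, hmul, h10, Or.inr ⟨fun h01 => hS α ?_, h11⟩⟩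
    have hDs : D = α • 1 := by
      ext i j
      fin_cases i <;> fin_cases j <;> simp [h00, h10, h01, ← h11]
    calc S = S * g * g⁻¹ := by rw [Matrix.mul_assoc, Matrix.mul_nonsing_inv _ hdet, Matrix.mul_one]
      _ = α • 1 := by
        rw [hmul, hDs, Matrix.mul_smul, Matrix.mul_one, Matrix.smul_mul,
          Matrix.mul_nonsing_inv _ hdet]
  · obtain ⟨c, t, hw⟩ := exists_eigenvector_of_det (S := S) (α := β) (by
      rw [← hα, det_sub_smul_one, det_sub_smul_one, hβ]
      ring)
    refine ⟨b, c, s, t, Matrix.diagonal ![α, β], ?_, hcol _ _ _ _ _ ?_ ?_, ?_, Or.inl ⟨?_, ?_⟩⟩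
    · rw [isUnit_iff_ne_zero]
      intro hdet
      obtain ⟨u, hu, hu0⟩ := Matrix.exists_mulVec_eq_zero_iff.2 hdet
      have hcomb : u 0 • chart b s + u 1 • chart c t = 0 := by
        rw [← hu0]
        ext i
        simp [frame, Matrix.mulVec, dotProduct, Fin.sum_univ_two, mul_comm]
      have hcomb2 := congrArg (fun x => S *ᵥ x) hcomb
      simp only [Matrix.mulVec_add, Matrix.mulVec_smul, hv, hw, Matrix.mulVec_zero] at hcomb2
      have h1 : (u 1 * (β - α)) • chart c t = 0 := by
        have : (u 1 * (β - α)) • chart c t = (u 0 • α • chart b s + u 1 • β • chart c t) -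
            α • (u 0 • chart b s + u 1 • chart c t) := by
          module
        rw [this, hcomb, hcomb2]
        simp
      have h0 : (u 0 * (α - β)) • chart b s = 0 := by
        have : (u 0 * (α - β)) • chart b s = (u 0 • α • chart b s + u 1 • β • chart c t) -
            β • (u 0 • chart b s + u 1 • chart c t) := by
          module
        rw [this, hcomb, hcomb2]
        simp
      have h1 := (smul_eq_zero.1 h1).resolve_right (chart_ne_zero c t)
      have h0 := (smul_eq_zero.1 h0).resolve_right (chart_ne_zero b s)
      have h1 := (mul_eq_zero.1 h1).resolve_right (sub_ne_zero.2 (Ne.symm hne))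
      have h0 := (mul_eq_zero.1 h0).resolve_right (sub_ne_zero.2 hne)
      exact hu (by ext i; fin_cases i <;> simp [h0, h1])
    · simp [hv]
    · simp [hw]
    · simp
    · simp
    · simpa using hne

end NormalForm

/-! ### A nonscalar symmetry leaves few nonzero amplitudes -/

section Support

variable {n : ℕ}

/-- The set of weights on which a permutation invariant function does not vanish. -/
noncomputable def weightSupport (v : BitString n → ℂ) : Finset ℕ :=
  (Finset.range (n + 1)).filter fun m => amplitude v m ≠ 0

theorem mem_weightSupport {v : BitString n → ℂ} {m : ℕ} :
    m ∈ weightSupport v ↔ m ≤ n ∧ amplitude v m ≠ 0 := by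
  simp [weightSupport]

/-- Halving is injective on a set without consecutive elements. -/
theorem card_le_of_no_consecutive {A : Finset ℕ} {N : ℕ} (hA : A ⊆ Finset.range (N + 1))
    (h : ∀ m ∈ A, m + 1 ∉ A) : A.card ≤ N / 2 + 1 := by
  rw [← Finset.card_range (N / 2 + 1)]
  refine Finset.card_le_card_of_injOn (· / 2) (fun m hm => ?_) fun m hm k hk hmk => ?_
  · have := Finset.mem_range.1 (hA hm)
    simp only [Finset.coe_range, Set.mem_Iio]
    omega
  · have h1 := h m hm
    have h2 := h k hk
    have hmk : m / 2 = k / 2 := hmk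
    by_contra hne
    rcases Nat.lt_or_gt_of_ne hne with hlt | hlt
    · obtain rfl : k = m + 1 := by omega
      exact h1 hk
    · obtain rfl : m = k + 1 := by omega
      exact h2 hm

theorem tensorOp_diagonal_mulVec {D : Matrix (Fin 2) (Fin 2) ℂ} (h01 : D 0 1 = 0) (h10 : D 1 0 = 0)
    (v : BitString n → ℂ) (x : BitString n) :
    (tensorOp (fun _ => D) *ᵥ v) x = (∏ k, D (x k) (x k)) * v x := by
  rw [Matrix.mulVec, dotProduct, Finset.sum_eq_single x]
  · rfl
  · intro y _ hy
    obtain ⟨k, hk⟩ := Function.ne_iff.1 hy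
    rw [tensorOp_apply, Finset.prod_eq_zero (Finset.mem_univ k), zero_mul]
    have : ∀ a b : Fin 2, b ≠ a → D a b = 0 := by
      intro a b hab
      fin_cases a <;> fin_cases b <;> simp_all
    exact this _ _ hk
  · simp

/-- Basis vectors are eigenvectors of `D ⊗ ⋯ ⊗ D`, and flipping one bit changes the eigenvalue by
the ratio of the distinct diagonal entries. So two consecutive weights cannot both occur. -/
theorem card_weightSupport_le_of_diagonal {v : BitString n → ℂ} {D : Matrix (Fin 2) (Fin 2) ℂ}
    (h01 : D 0 1 = 0) (h10 : D 1 0 = 0) (hD : D 0 0 ≠ D 1 1) {c : ℂ} (hc : c ≠ 0)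
    (h : tensorOp (fun _ => D) *ᵥ v = c • v) : (weightSupport v).card ≤ n / 2 + 1 := by
  refine card_le_of_no_consecutive (Finset.filter_subset _ _) fun m hm hm1 => hD ?_
  obtain ⟨-, hm⟩ := mem_weightSupport.1 hm
  obtain ⟨hmn, hm1⟩ := mem_weightSupport.1 hm1
  set s : Finset (Fin n) := Finset.univ.filter fun k => k.val < m
  have hins : (Finset.univ.filter fun k : Fin n => k.val < m + 1) = insert ⟨m, hmn⟩ s := by
    ext k
    simp only [s, Finset.mem_filter, Finset.mem_univ, true_and, Finset.mem_insert, Fin.ext_iff]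
    omega
  rw [amplitude] at hm
  rw [amplitude, hins] at hm1
  have hprod : ∀ x, v x ≠ 0 → ∏ k, D (x k) (x k) = c := by
    intro x hx
    have := congrFun h x
    rw [tensorOp_diagonal_mulVec h01 h10] at this
    exact mul_right_cancel₀ hx this
  have e0 := hprod _ hm
  have e1 := hprod _ hm1
  rw [← Finset.mul_prod_erase _ _ (Finset.mem_univ (⟨m, hmn⟩ : Fin n))] at e0 e1
  have hrest : ∏ k ∈ Finset.univ.erase (⟨m, hmn⟩ : Fin n), D (bits (insert ⟨m, hmn⟩ s) k)
      (bits (insert ⟨m, hmn⟩ s) k) =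
      ∏ k ∈ Finset.univ.erase (⟨m, hmn⟩ : Fin n), D (bits s k) (bits s k) :=
    Finset.prod_congr rfl fun k hk => by
      rw [← update_bits_one, Function.update_of_ne (Finset.ne_of_mem_erase hk)]
  have b0 : bits s ⟨m, hmn⟩ = 0 := by simp [bits, s]
  have b1 : bits (insert ⟨m, hmn⟩ s) ⟨m, hmn⟩ = 1 := by simp [bits]
  rw [b0] at e0
  rw [b1, hrest, ← e0] at e1
  refine (mul_right_cancel₀ (fun hz => hc ?_) e1).symm
  rw [← e0, hz, mul_zero]

/-- The rows of the tensor power of a triangular matrix with equal diagonal entries, applied to a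
function without weights above `M`. -/
theorem tensorOp_jordan_mulVec {v : BitString n → ℂ} (hv : PermInvariant v) {M : ℕ}
    (hM : ∀ m ≤ n, M < m → amplitude v m = 0)
    {D : Matrix (Fin 2) (Fin 2) ℂ} (h10 : D 1 0 = 0) (hD : D 0 0 = D 1 1) (x : BitString n)
    (hx : M ≤ (ones x).card + 1) :
    (tensorOp (fun _ => D) *ᵥ v) x = D 0 0 ^ n * v x +
      ((Finset.univ.erase x).filter fun y => ones x ⊆ ones y ∧ (ones y).card = M).card •
        (D 0 1 * D 0 0 ^ (n - 1) * amplitude v M) := by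
  rw [Matrix.mulVec, dotProduct, ← Finset.add_sum_erase _ _ (Finset.mem_univ x)]
  congr 1
  · rw [tensorOp_apply, Finset.prod_congr rfl (g := fun _ => D 0 0)]
    · simp
    · intro k _
      generalize x k = a
      fin_cases a
      · rfl
      · exact hD.symm
  rw [← Finset.sum_const, Finset.sum_filter]
  refine Finset.sum_congr rfl fun y hy => ?_
  have hyx : y ≠ x := Finset.ne_of_mem_erase hy
  by_cases hsub : ones x ⊆ ones y
  · have hss : ones x ⊂ ones y := hsub.ssubset_of_ne fun he => hyx (by
      rw [← bits_ones y, ← he, bits_ones])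
    have hlt := Finset.card_lt_card hss
    by_cases hcard : (ones y).card = M
    · rw [if_pos ⟨hsub, hcard⟩, hv.eq_amplitude y, hcard]
      congr 1
      have hdiff : (ones y \ ones x).card = 1 := by
        rw [Finset.card_sdiff_of_subset hsub]; omega
      obtain ⟨k, hk⟩ := Finset.card_eq_one.1 hdiff
      have hkm : k ∈ ones y \ ones x := by rw [hk]; exact Finset.mem_singleton_self k
      obtain ⟨hky, hkx⟩ := Finset.mem_sdiff.1 hkm
      rw [mem_ones] at hky
      rw [notMem_ones] at hkx
      rw [tensorOp_apply, ← Finset.mul_prod_erase _ _ (Finset.mem_univ k), hky, hkx]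
      congr 1
      rw [Finset.prod_congr rfl (g := fun _ => D 0 0)]
      · simp
      · intro j hj
        have hjk := Finset.ne_of_mem_erase hj
        have hxy : x j = y j := by
          by_cases hjx : j ∈ ones x
          · rw [mem_ones.1 hjx, mem_ones.1 (hsub hjx)]
          · have hjy : j ∉ ones y := fun hjy => hjk (by
              have : j ∈ ones y \ ones x := Finset.mem_sdiff.2 ⟨hjy, hjx⟩
              rwa [hk, Finset.mem_singleton] at this)
            rw [notMem_ones.1 hjx, notMem_ones.1 hjy]
        rw [hxy]
        generalize y j = a
        fin_cases a
        · rfl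
        · exact hD.symm
    · rw [if_neg fun h => hcard h.2, hv.eq_amplitude y,
        hM _ (card_finset_fin_le _) (by omega), mul_zero]
  · rw [if_neg fun h => hsub h.1]
    obtain ⟨k, hkx, hky⟩ := Finset.not_subset.1 hsub
    rw [tensorOp_apply, Finset.prod_eq_zero (Finset.mem_univ k), zero_mul]
    rw [mem_ones.1 hkx, notMem_ones.1 hky, h10]

/-- Only weight 0 can occur. Let `M > 0` be the highest weight present: a row of weight `M`
identifies the eigenvalue as `D 0 0 ^ n`, and a row of weight `M - 1` then contains a nonzero
contribution of weight `M` that nothing cancels. -/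
theorem card_weightSupport_le_of_jordan {v : BitString n → ℂ} (hv : PermInvariant v)
    {D : Matrix (Fin 2) (Fin 2) ℂ} (h10 : D 1 0 = 0) (h01 : D 0 1 ≠ 0) (hD : D 0 0 = D 1 1)
    (h00 : D 0 0 ≠ 0) {c : ℂ} (h : tensorOp (fun _ => D) *ᵥ v = c • v) :
    (weightSupport v).card ≤ n / 2 + 1 := by
  suffices hs : weightSupport v ⊆ {0} by
    have := Finset.card_le_card hs
    rw [Finset.card_singleton] at this
    omega
  intro m₀ hm₀
  by_contra hne
  have hnonempty : (weightSupport v).Nonempty := ⟨m₀, hm₀⟩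
  set M := (weightSupport v).max' hnonempty
  have hMmem : M ∈ weightSupport v := Finset.max'_mem _ _
  have hMm₀ : m₀ ≤ M := Finset.le_max' _ _ hm₀
  have hm₀0 : m₀ ≠ 0 := by simpa using hne
  obtain ⟨hMn, hMv⟩ := mem_weightSupport.1 hMmem
  have hM : ∀ m ≤ n, M < m → amplitude v m = 0 := by
    intro m hm hlt
    by_contra hm0
    exact absurd (Finset.le_max' _ _ (mem_weightSupport.2 ⟨hm, hm0⟩)) (not_le.2 hlt)
  obtain ⟨s, hs⟩ : ∃ s : Finset (Fin n), s.card = M := ⟨_, card_filter_val_lt hMn⟩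
  obtain ⟨k, hk⟩ : s.Nonempty := Finset.card_pos.1 (by omega)
  have hc : D 0 0 ^ n = c := by
    have e := tensorOp_jordan_mulVec hv hM h10 hD (bits s) (by rw [ones_bits]; omega)
    rw [h, Finset.card_eq_zero.2, zero_smul, add_zero, Pi.smul_apply, smul_eq_mul] at e
    · refine (mul_right_cancel₀ ?_ e).symm
      rwa [hv.apply_bits, hs]
    · refine Finset.filter_eq_empty_iff.2 fun y hy hsub => Finset.ne_of_mem_erase hy ?_
      rw [ones_bits] at hsub
      rw [Finset.eq_of_subset_of_card_le hsub.1 (by rw [hsub.2, hs]), bits_ones]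
  have e := tensorOp_jordan_mulVec hv hM h10 hD (bits (s.erase k)) (by
    rw [ones_bits, Finset.card_erase_of_mem hk]; omega)
  rw [h, hc, Pi.smul_apply, smul_eq_mul, left_eq_add, smul_eq_zero] at e
  rcases e with e | e
  · have hmem : bits s ∈ (Finset.univ.erase (bits (s.erase k))).filter
        fun y => ones (bits (s.erase k)) ⊆ ones y ∧ (ones y).card = M := by
      simp only [Finset.mem_filter, Finset.mem_erase, Finset.mem_univ, and_true, ones_bits, hs,
        Finset.erase_subset]
      intro he
      have := congrArg ones he
      rw [ones_bits, ones_bits] at this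
      exact Finset.notMem_erase k s (this ▸ hk)
    rw [Finset.card_eq_zero.1 e] at hmem
    exact Finset.notMem_empty _ hmem
  · exact mul_ne_zero (mul_ne_zero h01 (pow_ne_zero _ h00)) hMv e

/-- The states `g ⊗ ⋯ ⊗ g` applied to a symmetric state with weights in `A`, where the columns of
`g` are representatives of two points of the projective line. -/
noncomputable def frameState (n : ℕ) (A : Finset ℕ) (b c : Bool) (p : (ℂ × ℂ) × (A → ℂ)) : QubitState n :=
  WithLp.toLp 2 (tensorOp (fun _ => frame b c p.1.1 p.1.2) *ᵥ
    fun y => ∑ a : A, if (ones y).card = a then p.2 a else 0)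

/-- Passing to the basis given by `g` replaces `S` by its normal form `D`; the transformed state `χ`
is still symmetric and has small support. -/
theorem exists_frameState_eq {ψ : QubitState n} (hψ : PermInvariant ψ.ofLp)
    {S : Matrix (Fin 2) (Fin 2) ℂ} (hS : IsUnit S.det) (hS' : ∀ r : ℂ, S ≠ r • 1) {c : ℂ}
    (hc : c ≠ 0) (h : tensorOp (fun _ => S) *ᵥ ψ.ofLp = c • ψ.ofLp) :
    ∃ A ∈ (Finset.range (n + 1)).powerset, A.card ≤ n / 2 + 1 ∧
      ∃ (b d : Bool), ψ ∈ Set.range (frameState n A b d) := by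
  obtain ⟨b, d, s, t, D, hg, hSg, h10, hD⟩ := exists_frame_mul_eq hS'
  set g := frame b d s t with hgdef
  set χ := tensorOp (fun _ : Fin n => g⁻¹) *ᵥ ψ.ofLp with hχ
  have hχinv : PermInvariant χ := hψ.tensorOp_mulVec _
  have hψχ : ψ.ofLp = tensorOp (fun _ => g) *ᵥ χ := by
    rw [hχ, Matrix.mulVec_mulVec, tensorOp_mul_inv fun _ => hg, Matrix.one_mulVec]
  have hDχ : tensorOp (fun _ => D) *ᵥ χ = c • χ := by
    have hDg : D * g⁻¹ = g⁻¹ * S := by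
      calc D * g⁻¹ = g⁻¹ * (g * D) * g⁻¹ := by
            rw [← Matrix.mul_assoc, Matrix.nonsing_inv_mul _ hg, Matrix.one_mul]
        _ = g⁻¹ * S := by
            rw [← hSg, Matrix.mul_assoc, Matrix.mul_assoc, Matrix.mul_nonsing_inv _ hg,
              Matrix.mul_one]
    rw [hχ, Matrix.mulVec_mulVec, tensorOp_mul, hDg, ← tensorOp_mul, ← Matrix.mulVec_mulVec, h,
      Matrix.mulVec_smul]
  have hcard : (weightSupport χ).card ≤ n / 2 + 1 := by
    rcases hD with ⟨h01, hne⟩ | ⟨h01, heq⟩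
    · exact card_weightSupport_le_of_diagonal h01 h10 hne hc hDχ
    · refine card_weightSupport_le_of_jordan hχinv h10 h01 heq (fun h00 => ?_) hDχ
      have := congrArg Matrix.det hSg
      rw [Matrix.det_mul, Matrix.det_mul, Matrix.det_fin_two D, h00, h10, zero_mul, mul_zero,
        sub_zero, mul_zero] at this
      exact (hS.mul hg).ne_zero this
  refine ⟨weightSupport χ, Finset.mem_powerset.2 (Finset.filter_subset _ _), hcard, b, d,
    ((s, t), fun a => amplitude χ a), ?_⟩
  have hsum : (fun y : BitString n => ∑ a : weightSupport χ,
      if (ones y).card = a then amplitude χ a else 0) = χ := by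
    ext y
    rw [hχinv.eq_amplitude y, Finset.sum_coe_sort (weightSupport χ)
      fun a => if (ones y).card = a then amplitude χ a else 0, Finset.sum_ite_eq]
    split_ifs with hy
    · rfl
    · by_contra h0
      exact hy (mem_weightSupport.2 ⟨card_finset_fin_le _, Ne.symm h0⟩)
  ext1 x
  simp only [frameState]
  rw [hsum, hψχ]

end Support

/-! ### Null sets and the generic state -/

section Generic

/-- A C¹ map does not raise Hausdorff dimension, and Haar measure is absolutely continuous with
respect to the Hausdorff measure of full real dimension. -/
theorem measure_range_eq_zero_of_contDiff {E F : Type*} [NormedAddCommGroup E] [NormedSpace ℂ E]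
    [FiniteDimensional ℂ E] [NormedAddCommGroup F] [NormedSpace ℂ F] [FiniteDimensional ℂ F]
    [MeasurableSpace F] [BorelSpace F] (μ : Measure F) [μ.IsAddHaarMeasure] {f : E → F}
    (hf : ContDiff ℂ 1 f) (h : Module.finrank ℂ E < Module.finrank ℂ F) : μ (Set.range f) = 0 := by
  have : FiniteDimensional ℝ E := FiniteDimensional.complexToReal E
  have : FiniteDimensional ℝ F := FiniteDimensional.complexToReal F
  have hf : ContDiff ℝ 1 f := hf.restrict_scalars ℝ
  have hac : μ ≪ Measure.hausdorffMeasure (Module.finrank ℝ F) :=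
    Measure.absolutelyContinuous_isAddHaarMeasure μ _
  refine hac ?_
  have := hausdorffMeasure_of_dimH_lt (X := F) (s := Set.range f)
    (d := (Module.finrank ℝ F : NNReal)) (hf.dimH_range_le.trans_lt (by
      rw [finrank_real_of_complex, finrank_real_of_complex]
      exact_mod_cast (by omega : 2 * Module.finrank ℂ E < 2 * Module.finrank ℂ F)))
  simpa using this

variable {n : ℕ}

/-- The symmetric state with prescribed amplitudes. -/
def symOfAmplitudes (n : ℕ) : (Fin (n + 1) → ℂ) →ₗ[ℂ] symSubspace n where
  toFun a := ⟨WithLp.toLp 2 fun x => a ⟨(ones x).card, Nat.lt_succ_of_le (card_finset_fin_le _)⟩, by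
    intro i j x
    have : (ones (x ∘ Equiv.swap i j)).card = (ones x).card :=
      Finset.card_equiv (Equiv.swap i j) fun k => by simp [mem_ones]
    simp only [this]⟩
  map_add' _ _ := rfl
  map_smul' _ _ := rfl

theorem amplitude_symOfAmplitudes (a : Fin (n + 1) → ℂ) (m : Fin (n + 1)) :
    amplitude (symOfAmplitudes n a : QubitState n).ofLp m = a m := by
  change a _ = a m
  congr 1
  ext
  simp only [ones_bits]
  exact card_filter_val_lt (Nat.le_of_lt_succ m.2)

theorem lt_finrank_symSubspace (n : ℕ) : n < Module.finrank ℂ (symSubspace n) := by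
  have hinj : Function.Injective (symOfAmplitudes n) := by
    intro a b hab
    ext m
    rw [← amplitude_symOfAmplitudes a m, hab, amplitude_symOfAmplitudes]
  simpa using LinearMap.finrank_le_finrank_of_injective hinj

theorem contDiff_frameState (A : Finset ℕ) (b c : Bool) : ContDiff ℂ 1 (frameState n A b c) := by
  rw [contDiff_euclidean]
  intro x
  simp only [frameState, Matrix.mulVec, dotProduct, tensorOp_apply]
  have hframe : ∀ i j, ContDiff ℂ 1 fun p : (ℂ × ℂ) × (A → ℂ) => frame b c p.1.1 p.1.2 i j := by
    intro i j
    fin_cases i <;> fin_cases j <;> cases b <;> cases c <;> simp [frame, chart] <;> fun_prop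
  refine ContDiff.sum fun y _ => ContDiff.mul (contDiff_prod fun k _ => hframe _ _)
    (ContDiff.sum fun a _ => ?_)
  split_ifs
  · fun_prop
  · exact contDiff_const

/-- Composing with the orthogonal projection gives a map into the symmetric subspace, where `μ`
lives. The projection fixes symmetric states, so none in the range is lost. -/
theorem ae_notMem_range_frameState (μ : Measure (symSubspace n)) [μ.IsAddHaarMeasure]
    {A : Finset ℕ} (hA : A.card + 2 ≤ n) (b c : Bool) :
    ∀ᵐ ψ : symSubspace n ∂μ, (ψ : QubitState n) ∉ Set.range (frameState n A b c) := by
  have h := measure_range_eq_zero_of_contDiff μ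
    ((symSubspace n).orthogonalProjectionOnto.contDiff.comp (contDiff_frameState A b c)) (by
      refine lt_of_le_of_lt ?_ (lt_finrank_symSubspace n)
      simp
      omega)
  refine (measure_eq_zero_iff_ae_notMem.1 h).mono ?_
  rintro ψ hψ ⟨p, hp⟩
  exact hψ ⟨p, by simp [hp]⟩

/-- It suffices to treat each complex line in the direction `v`, which moves only the weight-two
amplitude. This entry fills the antidiagonal of the Hankel matrix, so the determinant is a cubic in
`z` with leading coefficient -1 and finitely many roots. -/
theorem ae_hankelDet_ne_zero (hn : 4 ≤ n) (μ : Measure (symSubspace n)) [μ.IsAddHaarMeasure] :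
    ∀ᵐ ψ : symSubspace n ∂μ, hankelDet (amplitude (ψ : QubitState n).ofLp) ≠ 0 := by
  set v : symSubspace n := symOfAmplitudes n (Pi.single ⟨2, by omega⟩ 1) with hv
  have hamp : ∀ (ψ : symSubspace n) (z : ℂ) (m : ℕ), m ≤ 4 →
      amplitude ((ψ + z • v : symSubspace n) : QubitState n).ofLp m =
        amplitude (ψ : QubitState n).ofLp m + if m = 2 then z else 0 := by
    intro ψ z m hm
    have := amplitude_symOfAmplitudes (n := n) (Pi.single ⟨2, by omega⟩ 1) ⟨m, by omega⟩
    rw [← hv] at this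
    have hadd : amplitude ((ψ + z • v : symSubspace n) : QubitState n).ofLp m =
      amplitude (ψ : QubitState n).ofLp m + z * amplitude (v : QubitState n).ofLp m := rfl
    rw [hadd, this, Pi.single_apply]
    simp [Fin.ext_iff]
  have hcont : Continuous fun ψ : symSubspace n =>
      hankelDet (amplitude (ψ : QubitState n).ofLp) := by
    unfold hankelDet amplitude
    fun_prop
  have hmeas : MeasurableSet {ψ : symSubspace n |
      hankelDet (amplitude (ψ : QubitState n).ofLp) ≠ 0} :=
    (isOpen_ne_fun hcont continuous_const).measurableSet
  refine ae_mem_of_ae_add_linearMap_mem (LinearMap.toSpanSingleton ℂ (symSubspace n) v)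
    (volume : Measure ℂ) μ hmeas fun ψ => ?_
  set a := amplitude (ψ : QubitState n).ofLp
  set P : Cubic ℂ := ⟨-1, -3 * a 2, a 0 * a 4 + 2 * a 1 * a 3 - 3 * a 2 ^ 2, hankelDet a⟩
  have hP : P.toPoly ≠ 0 := Cubic.ne_zero_of_a_ne_zero (by simp [P])
  have hfin : (P.toPoly.rootSet ℂ).Finite := P.toPoly.rootSet_finite ℂ
  refine (measure_eq_zero_iff_ae_notMem.1 (hfin.measure_zero volume)).mono fun z hz => ?_
  intro h0
  refine hz ((Polynomial.mem_rootSet).2 ⟨hP, ?_⟩)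
  rw [LinearMap.toSpanSingleton_apply, hankelDet, hamp _ _ 0 (by norm_num),
    hamp _ _ 1 (by norm_num), hamp _ _ 2 (by norm_num), hamp _ _ 3 (by norm_num),
    hamp _ _ 4 (by norm_num)] at h0
  norm_num at h0
  simp only [Cubic.toPoly, P, hankelDet]
  simp
  linear_combination h0

theorem localStabilizer_eq_singleton_of_generic (hn : 4 ≤ n) {ψ : QubitState n}
    (hψ : PermInvariant ψ.ofLp) (hH : hankelDet (amplitude ψ.ofLp) ≠ 0)
    (hgen : ∀ A ∈ (Finset.range (n + 1)).powerset, A.card ≤ n / 2 + 1 → ∀ b c : Bool,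
      ψ ∉ Set.range (frameState n A b c)) : localStabilizer ψ = {1} := by
  refine Set.Subset.antisymm ?_ ?_
  · rintro _ ⟨S, rfl, hS⟩
    have hS : tensorOp (fun k => (S k : Matrix (Fin 2) (Fin 2) ℂ)) *ᵥ ψ.ofLp = ψ.ofLp :=
      congrArg WithLp.ofLp hS
    have hdet : ∀ k, IsUnit (S k : Matrix (Fin 2) (Fin 2) ℂ).det := fun k =>
      (Matrix.isUnit_iff_isUnit_det _).1 (S k).isUnit
    have hψ0 : ψ.ofLp ≠ 0 := by
      intro h0
      exact hH (by simp [h0, hankelDet, amplitude])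
    set i : Fin n := ⟨0, by omega⟩
    choose r hr using exists_smul_of_tensorOp_mulVec_eq hn hψ hH hdet hS i
    have hT : tensorOp (fun k => (S k : Matrix (Fin 2) (Fin 2) ℂ)) =
        (∏ k, r k) • tensorOp fun _ => (S i : Matrix (Fin 2) (Fin 2) ℂ) := by
      rw [← tensorOp_smul]
      exact congrArg tensorOp (funext hr)
    have hr0 : ∏ k, r k ≠ 0 := by
      intro h0
      rw [hT, h0, zero_smul, Matrix.zero_mulVec] at hS
      exact hψ0 hS.symm
    have hSi : tensorOp (fun _ => (S i : Matrix (Fin 2) (Fin 2) ℂ)) *ᵥ ψ.ofLp =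
        (∏ k, r k)⁻¹ • ψ.ofLp := by
      rw [hT, Matrix.smul_mulVec] at hS
      rw [eq_inv_smul_iff₀ hr0, hS]
    by_cases hscal : ∃ q : ℂ, (S i : Matrix (Fin 2) (Fin 2) ℂ) = q • 1
    · obtain ⟨q, hq⟩ := hscal
      rw [hq, tensorOp_smul (fun _ => q) fun _ => 1, tensorOp_one, smul_smul] at hT
      rw [hT, Matrix.smul_mulVec, Matrix.one_mulVec] at hS
      obtain ⟨x, hx⟩ := Function.ne_iff.1 hψ0
      have := congrFun hS x
      rw [Pi.smul_apply, smul_eq_mul, mul_eq_right₀ hx] at this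
      rw [Set.mem_singleton_iff, hT, this, one_smul]
    · push Not at hscal
      obtain ⟨A, hA, hcard, b, d, hmem⟩ :=
        exists_frameState_eq hψ (hdet i) hscal (inv_ne_zero hr0) hSi
      exact absurd hmem (hgen A hA hcard b d)
  · rintro _ rfl
    exact ⟨fun _ => 1, by simp [tensorOp_one], by simp⟩

end Generic

theorem theorem5 (n : ℕ) (hn : 5 ≤ n)
    (μ : Measure (symSubspace n)) [μ.IsAddHaarMeasure] :
    ∀ᵐ ψ : symSubspace n ∂μ, localStabilizer (ψ : QubitState n) = {1} ∧
      FullyEntangled (ψ : QubitState n) ∧ LOCCIsolated (ψ : QubitState n) := by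
  have hgen : ∀ᵐ ψ : symSubspace n ∂μ, ∀ A ∈ (Finset.range (n + 1)).powerset,
      A.card ≤ n / 2 + 1 → ∀ b c : Bool, (ψ : QubitState n) ∉ Set.range (frameState n A b c) := by
    refine (Filter.eventually_all_finset _).2 fun A _ => ?_
    refine ae_all_iff.2 fun hA => ae_all_iff.2 fun b => ae_all_iff.2 fun c => ?_
    -- The bound `n / 2 + 3 ≤ n` is where `5 ≤ n` is needed.
    exact ae_notMem_range_frameState μ (by omega) b c
  filter_upwards [ae_hankelDet_ne_zero (by omega) μ, hgen] with ψ hH hψ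
  have hinv := permInvariant_of_mem_symSubspace ψ.2
  have hstab := localStabilizer_eq_singleton_of_generic (by omega) hinv hH hψ
  have hfe := fullyEntangled_of_hankelDet (by omega) hinv hH
  exact ⟨hstab, hfe, LOCCIsolated.of_localStabilizer (by omega) hstab hfe⟩
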